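/- Let $k$ be a field and $\otimes=\otimes_k$. A quasi-Hopf algebra over $k$ is a unital associative $k$-algebra $H$ with unital algebra maps $\Delta:H\to H\otimes H$, $\varepsilon:H\to k$, an invertible element $\Phi\in H^{\otimes 3}$, a unital linear anti-multiplicative map $S:H\to H$ and elements $\alpha,\beta\in H$ such that, writing $\Delta(h)=h_1\otimes h_2$, $\Phi=X^1\otimes X^2\otimes X^3$, $\Phi^{-1}=x^1\otimes x^2\otimes x^3$ (summation understood), for all $h\in H$: $$(\mathrm{id}\otimes\Delta)\Delta(h)=\Phi\,(\Delta\otimes\mathrm{id})\Delta(h)\,\Phi^{-1},\qquad (\mathrm{id}\otimes\varepsilon)\Delta(h)=h=(\varepsilon\otimes\mathrm{id})\Delta(h),$$ $$(1\otimes\Phi)(\mathrm{id}\otimes\Delta\otimes\mathrm{id})(\Phi)(\Phi\otimes1)=(\mathrm{id}\otimes\mathrm{id}\otimes\Delta)(\Phi)(\Delta\otimes\mathrm{id}\otimes\mathrm{id})(\Phi),\qquad(\mathrm{id}\otimes\varepsilon\otimes\mathrm{id})(\Phi)=1\otimes1,$$ $$S(h_1)\alpha h_2=\varepsilon(h)\alpha,\quad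 h_1\beta S(h_2)=\varepsilon(h)\beta,\quad X^1\beta S(X^2)\alpha X^3=1,\quad S(x^1)\alpha x^2\beta S(x^3)=1 .$$ Let $H$ be a finite-dimensional quasi-Hopf algebra over $k$. On $H^*$ let $(\xi*\nu)(y)=\xi(y_1)\nu(y_2)$ and $(a\rightharpoonup\xi)(y)=\xi(ya)$. The first Heisenberg double $\mathcal H_1(H^*)$ is the space $H^*\otimes H$, with $\xi\otimes a$ written $\xi\# a$, and the (in general nonassociative) product $$(\xi\# a)(\nu\# b)=(x^1\rightharpoonup\xi)*(x^2a_1\rightharpoonup\nu)\,\#\,x^3a_2b .$$ Its tensor powers carry the componentwise product. Put $\Delta^{\mathrm{cop}}(h)=h_2\otimes h_1$ and $$\gamma=S(X^2x^1_2)\alpha X^3x^2\otimes S(X^1x^1_1)\alpha x^3,\qquad \delta=X^1_1x^1\beta S(X^3)\otimes X^1_2x^2\beta S(X^2x^3),$$ $$f=(S\otimes S)(\Delta^{\mathrm{cop}}(x^1))\,\gamma\,\Delta(x^2\beta S(x^3)),\qquad g=g^1\otimes g^2=\Delta(S(x^1)\alpha x^2)\,\delta\,(S\otimes S)(\Delta^{\mathrm{cop}}(x^3)).$$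 Then $S$ is bijective and $fg=gf=1\otimes1$, that is, the Drinfel'd twist $f$ is invertible with $f^{-1}=g$. Define $$q_R=q^1\otimes q^2=X^1\otimes S^{-1}(\alpha X^3)X^2,\qquad U=U^1\otimes U^2=g^1S(q^2)\otimes g^2S(q^1).$$ Let $\{e_i\}_{i\in I}$ be any basis of $H$ with dual basis $\{e^i\}_{i\in I}$, and let $$W=\sum_{i}\varepsilon\# e_i\otimes e^i\#1,\qquad \tilde W=\sum_i\varepsilon\# S(e_iU^1)\otimes e^i\#U^2\in\mathcal H_1(H^*)^{\otimes2},$$ $$\boldsymbol\Phi^{-1}=\varepsilon\#x^1\otimes\varepsilon\#x^2\otimes\varepsilon\#x^3,\qquad \boldsymbol\Phi^{321}_S=\varepsilon\#S(X^3)\otimes\varepsilon\#S(X^2)\otimes\varepsilon\#S(X^1)\in\mathcal H_1(H^*)^{\otimes3}.$$ For $w\in\mathcal H_1(H^*)^{\otimes2}$ let $w_{12},w_{13},w_{23}\in\mathcal H_1(H^*)^{\otimes3}$ be obtained by inserting $\varepsilon\#1$ in the remaining factor. Then each of the four triple products below is independent of its bracketing, and $$W_{12}W_{13}W_{23}=W_{23}W_{12}\boldsymbol\Phi^{-1},\qquad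 \tilde W_{23}\tilde W_{13}\tilde W_{12}=\boldsymbol\Phi^{321}_S\tilde W_{12}\tilde W_{23}.$$ -/

import Mathlib

open scoped TensorProduct

noncomputable section

/-- A quasi-bialgebra over `k`. The triple tensor power is `(H ⊗ H) ⊗ H` and the fourfold one is
`((H ⊗ H) ⊗ H) ⊗ H`; `Algebra.TensorProduct.assoc` only moves brackets. -/
class QuasiBialgebra (k : Type*) (H : Type*) [Field k] [Ring H] [Algebra k H] where
  /-- the coproduct `Δ` -/
  comul : H →ₐ[k] H ⊗[k] H
  /-- the counit `ε` -/
  counit : H →ₐ[k] k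
  /-- the associator `Φ`, an invertible element -/
  assoc : ((H ⊗[k] H) ⊗[k] H)ˣ
  /-- `(id ⊗ Δ)(Δ(h)) = Φ (Δ ⊗ id)(Δ(h)) Φ⁻¹` -/
  quasi_coassoc : ∀ h : H,
    (Algebra.TensorProduct.assoc k k k H H H).symm
        (Algebra.TensorProduct.map (AlgHom.id k H) comul (comul h)) =
      (assoc : (H ⊗[k] H) ⊗[k] H) *
        Algebra.TensorProduct.map comul (AlgHom.id k H) (comul h) *
        ((assoc⁻¹ : ((H ⊗[k] H) ⊗[k] H)ˣ) : (H ⊗[k] H) ⊗[k] H)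
  /-- `(id ⊗ ε)(Δ(h)) = h` -/
  counit_right : ∀ h : H,
    Algebra.TensorProduct.rid k k H
      (Algebra.TensorProduct.map (AlgHom.id k H) counit (comul h)) = h
  /-- `(ε ⊗ id)(Δ(h)) = h` -/
  counit_left : ∀ h : H,
    Algebra.TensorProduct.lid k H
      (Algebra.TensorProduct.map counit (AlgHom.id k H) (comul h)) = h
  /-- `(1 ⊗ Φ) (id ⊗ Δ ⊗ id)(Φ) (Φ ⊗ 1) = (id ⊗ id ⊗ Δ)(Φ) (Δ ⊗ id ⊗ id)(Φ)` -/
  pentagon :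
    Algebra.TensorProduct.map
          (Algebra.TensorProduct.map
            (Algebra.TensorProduct.includeRight : H →ₐ[k] H ⊗[k] H) (AlgHom.id k H))
          (AlgHom.id k H) (assoc : (H ⊗[k] H) ⊗[k] H) *
        Algebra.TensorProduct.map
          ((Algebra.TensorProduct.assoc k k k H H H).symm.toAlgHom.comp
            (Algebra.TensorProduct.map (AlgHom.id k H) comul))
          (AlgHom.id k H) (assoc : (H ⊗[k] H) ⊗[k] H) *
        ((assoc : (H ⊗[k] H) ⊗[k] H) ⊗ₜ[k] (1 : H)) =
      (Algebra.TensorProduct.assoc k k k (H ⊗[k] H) H H).symm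
          (Algebra.TensorProduct.map (AlgHom.id k (H ⊗[k] H)) comul
            (assoc : (H ⊗[k] H) ⊗[k] H)) *
        Algebra.TensorProduct.map (Algebra.TensorProduct.map comul (AlgHom.id k H))
          (AlgHom.id k H) (assoc : (H ⊗[k] H) ⊗[k] H)
  /-- `(id ⊗ ε ⊗ id)(Φ) = 1 ⊗ 1` -/
  assoc_counit :
    Algebra.TensorProduct.map
        ((Algebra.TensorProduct.rid k k H).toAlgHom.comp
          (Algebra.TensorProduct.map (AlgHom.id k H) counit))
        (AlgHom.id k H) (assoc : (H ⊗[k] H) ⊗[k] H) = 1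

namespace QuasiHopf

variable {k H : Type*} [Field k] [Ring H] [Algebra k H]

/-- For `S : H → H` and `α ∈ H`, the linear map `a ⊗ b ↦ S(a) α b`. -/
def capMap (S : H →ₗ[k] H) (α : H) : H ⊗[k] H →ₗ[k] H :=
  LinearMap.mul' k H ∘ₗ TensorProduct.map S (LinearMap.mulLeft k α)

theorem capMap_tmul (S : H →ₗ[k] H) (α a b : H) :
    capMap S α (a ⊗ₜ[k] b) = S a * (α * b) := by
  simp [capMap]

/-- For `S : H → H` and `β ∈ H`, the linear map `a ⊗ b ↦ a β S(b)`. -/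
def cupMap (S : H →ₗ[k] H) (β : H) : H ⊗[k] H →ₗ[k] H :=
  LinearMap.mul' k H ∘ₗ TensorProduct.map (LinearMap.mulRight k β) S

theorem cupMap_tmul (S : H →ₗ[k] H) (β a b : H) :
    cupMap S β (a ⊗ₜ[k] b) = a * β * S b := by
  simp [cupMap]

end QuasiHopf

/-- A quasi-Hopf algebra over `k`: a quasi-bialgebra with an anti-algebra map `S` (not assumed
bijective) and elements `α`, `β`. -/
class QuasiHopfAlgebra (k : Type*) (H : Type*) [Field k] [Ring H] [Algebra k H] extends
    QuasiBialgebra k H where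
  /-- the antipode `S` -/
  antipode : H →ₗ[k] H
  /-- the element `α` -/
  alpha : H
  /-- the element `β` -/
  beta : H
  antipode_one : antipode 1 = 1
  antipode_mul : ∀ a b : H, antipode (a * b) = antipode b * antipode a
  /-- `S(h₁) α h₂ = ε(h) α` -/
  antipode_alpha : ∀ h : H, QuasiHopf.capMap antipode alpha (comul h) = counit h • alpha
  /-- `h₁ β S(h₂) = ε(h) β` -/
  antipode_beta : ∀ h : H, QuasiHopf.cupMap antipode beta (comul h) = counit h • beta
  /-- `X¹ β S(X²) α X³ = 1`, where `Φ = X¹ ⊗ X² ⊗ X³` -/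
  assoc_antipode :
    LinearMap.mul' k H
      (TensorProduct.map (QuasiHopf.cupMap antipode beta) (LinearMap.mulLeft k alpha)
        (assoc : (H ⊗[k] H) ⊗[k] H)) = 1
  /-- `S(x¹) α x² β S(x³) = 1`, where `Φ⁻¹ = x¹ ⊗ x² ⊗ x³` -/
  assoc_inv_antipode :
    LinearMap.mul' k H
      (TensorProduct.map (QuasiHopf.capMap antipode alpha) (LinearMap.mulLeft k beta ∘ₗ antipode)
        ((assoc⁻¹ : ((H ⊗[k] H) ⊗[k] H)ˣ) : (H ⊗[k] H) ⊗[k] H)) = 1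

namespace QuasiHopf

section Twist

variable (k H : Type*) [Field k] [Ring H] [Algebra k H]

/-- The coproduct as a linear map. -/
def comulL [QuasiBialgebra k H] : H →ₗ[k] H ⊗[k] H :=
  (QuasiBialgebra.comul : H →ₐ[k] H ⊗[k] H).toLinearMap

/-- The associator `Φ = X¹ ⊗ X² ⊗ X³`. -/
def Phi [QuasiBialgebra k H] : (H ⊗[k] H) ⊗[k] H :=
  ((QuasiBialgebra.assoc : ((H ⊗[k] H) ⊗[k] H)ˣ) : (H ⊗[k] H) ⊗[k] H)

/-- The inverse associator `Φ⁻¹ = x¹ ⊗ x² ⊗ x³`. -/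
def PhiInv [QuasiBialgebra k H] : (H ⊗[k] H) ⊗[k] H :=
  (((QuasiBialgebra.assoc : ((H ⊗[k] H) ⊗[k] H)ˣ)⁻¹ : ((H ⊗[k] H) ⊗[k] H)ˣ) :
    (H ⊗[k] H) ⊗[k] H)

variable [QuasiHopfAlgebra k H]

/-- The antipode `S`. -/
abbrev S : H →ₗ[k] H := QuasiHopfAlgebra.antipode

/-- The element `α`. -/
abbrev α : H := QuasiHopfAlgebra.alpha k

/-- The element `β`. -/
abbrev β : H := QuasiHopfAlgebra.beta k

/-- `a ⊗ b ↦ S(a) α b`. -/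
abbrev cap : H ⊗[k] H →ₗ[k] H := capMap (S k H) (α k H)

/-- `a ⊗ b ↦ a β S(b)`. -/
abbrev cup : H ⊗[k] H →ₗ[k] H := cupMap (S k H) (β k H)

/-- `h ↦ (S ⊗ S)(Δᶜᵒᵖ(h)) = S(h₂) ⊗ S(h₁)`. -/
def antipodeCop : H →ₗ[k] H ⊗[k] H :=
  TensorProduct.map (S k H) (S k H) ∘ₗ (TensorProduct.comm k H H).toLinearMap ∘ₗ comulL k H

/-- `a ⊗ b ⊗ c ⊗ d ↦ S(b) α c ⊗ S(a) α d`. -/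
def gammaMap : ((H ⊗[k] H) ⊗[k] H) ⊗[k] H →ₗ[k] H ⊗[k] H :=
  TensorProduct.map (cap k H) (cap k H) ∘ₗ
    (TensorProduct.assoc k (H ⊗[k] H) H H).toLinearMap ∘ₗ
    TensorProduct.map
      ((TensorProduct.comm k H (H ⊗[k] H)).toLinearMap ∘ₗ
        (TensorProduct.assoc k H H H).toLinearMap)
      LinearMap.id

theorem gammaMap_tmul (a b c d : H) :
    gammaMap k H (((a ⊗ₜ[k] b) ⊗ₜ[k] c) ⊗ₜ[k] d) =
      (S k H b * (α k H * c)) ⊗ₜ[k] (S k H a * (α k H * d)) := by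
  simp [gammaMap, capMap_tmul]

/-- `γ = S(X² x¹₂) α X³ x² ⊗ S(X¹ x¹₁) α x³`, the image of
`(Φ ⊗ 1) (Δ ⊗ id ⊗ id)(Φ⁻¹) = X¹ x¹₁ ⊗ X² x¹₂ ⊗ X³ x² ⊗ x³`. -/
def gamma : H ⊗[k] H :=
  gammaMap k H
    ((Phi k H ⊗ₜ[k] (1 : H)) *
      TensorProduct.map (TensorProduct.map (comulL k H) LinearMap.id) LinearMap.id (PhiInv k H))

/-- `a ⊗ b ⊗ c ⊗ d ↦ a β S(d) ⊗ b β S(c)`. -/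
def deltaMap : ((H ⊗[k] H) ⊗[k] H) ⊗[k] H →ₗ[k] H ⊗[k] H :=
  TensorProduct.map (cup k H) (cup k H) ∘ₗ
    (TensorProduct.assoc k H H (H ⊗[k] H)).symm.toLinearMap ∘ₗ
    TensorProduct.map LinearMap.id (TensorProduct.comm k (H ⊗[k] H) H).toLinearMap ∘ₗ
    (TensorProduct.assoc k H (H ⊗[k] H) H).toLinearMap ∘ₗ
    TensorProduct.map (TensorProduct.assoc k H H H).toLinearMap LinearMap.id

theorem deltaMap_tmul (a b c d : H) :
    deltaMap k H (((a ⊗ₜ[k] b) ⊗ₜ[k] c) ⊗ₜ[k] d) =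
      (a * β k H * S k H d) ⊗ₜ[k] (b * β k H * S k H c) := by
  simp [deltaMap, cupMap_tmul]

/-- `δ = X¹₁ x¹ β S(X³) ⊗ X¹₂ x² β S(X² x³)`, the image of
`(Δ ⊗ id ⊗ id)(Φ) (Φ⁻¹ ⊗ 1) = X¹₁ x¹ ⊗ X¹₂ x² ⊗ X² x³ ⊗ X³`. -/
def delta : H ⊗[k] H :=
  deltaMap k H
    (TensorProduct.map (TensorProduct.map (comulL k H) LinearMap.id) LinearMap.id (Phi k H) *
      (PhiInv k H ⊗ₜ[k] (1 : H)))

/-- The Drinfel'd twist `f = (S ⊗ S)(Δᶜᵒᵖ(x¹)) γ Δ(x² β S(x³))`. -/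
def twist : H ⊗[k] H :=
  LinearMap.mul' k (H ⊗[k] H)
    (TensorProduct.map
      (LinearMap.mulRight k (gamma k H) ∘ₗ antipodeCop k H)
      (comulL k H ∘ₗ cup k H)
      (TensorProduct.assoc k H H H (PhiInv k H)))

/-- The element `f⁻¹ = Δ(S(x¹) α x²) δ (S ⊗ S)(Δᶜᵒᵖ(x³))`. -/
def twistInv : H ⊗[k] H :=
  LinearMap.mul' k (H ⊗[k] H)
    (TensorProduct.map
      (LinearMap.mulRight k (delta k H) ∘ₗ comulL k H ∘ₗ cap k H)
      (antipodeCop k H)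
      (PhiInv k H))

open Classical in
/-- The inverse `S⁻¹` of the antipode (with value `0` if `S` is not bijective). -/
def antipodeInv : H →ₗ[k] H :=
  if h : Function.Bijective (S k H) then (LinearEquiv.ofBijective (S k H) h).symm.toLinearMap
  else 0

/-- `q_R = q¹ ⊗ q² = X¹ ⊗ S⁻¹(α X³) X²`. -/
def qR : H ⊗[k] H :=
  TensorProduct.map LinearMap.id
    (LinearMap.mul' k H ∘ₗ
      TensorProduct.map (antipodeInv k H ∘ₗ LinearMap.mulLeft k (α k H)) LinearMap.id ∘ₗ
      (TensorProduct.comm k H H).toLinearMap)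
    (TensorProduct.assoc k H H H (Phi k H))

/-- `U = g¹ S(q²) ⊗ g² S(q¹)`, where `f⁻¹ = g¹ ⊗ g²`. -/
def U : H ⊗[k] H :=
  twistInv k H *
    TensorProduct.map (S k H) (S k H) (TensorProduct.comm k H H (qR k H))

end Twist

section Double

variable (k H : Type*) [Field k] [Ring H] [Algebra k H]

/-- The left action `a ↦ (ξ ↦ a ⇀ ξ)` of `H` on `H*`, `(a ⇀ ξ)(y) = ξ(y a)`, here as a linear map
in `a` for fixed `ξ`. -/
def hit (ξ : Module.Dual k H) : H →ₗ[k] Module.Dual k H :=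
  LinearMap.llcomp k H H k ξ ∘ₗ (LinearMap.mul k H).flip

theorem hit_apply (ξ : Module.Dual k H) (a y : H) : hit k H ξ a y = ξ (y * a) := by
  simp [hit]

theorem hit_add (ξ ν : Module.Dual k H) : hit k H (ξ + ν) = hit k H ξ + hit k H ν := by
  ext; simp [hit_apply]

theorem hit_smul (c : k) (ξ : Module.Dual k H) : hit k H (c • ξ) = c • hit k H ξ := by
  ext; simp [hit_apply]

theorem mulRight_add (a b : H) :
    LinearMap.mulRight k (a + b) = LinearMap.mulRight k a + LinearMap.mulRight k b := by
  ext; simp [mul_add]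

theorem mulRight_smul (c : k) (a : H) :
    LinearMap.mulRight k (c • a) = c • LinearMap.mulRight k a := by
  ext; simp

variable [QuasiBialgebra k H]

/-- The counit as an element of `H*`. -/
def eps : Module.Dual k H := (QuasiBialgebra.counit : H →ₐ[k] k).toLinearMap

/-- The convolution product on `H*`: `(ξ ∗ ν)(y) = ξ(y₁) ν(y₂)`. -/
def conv : Module.Dual k H ⊗[k] Module.Dual k H →ₗ[k] Module.Dual k H :=
  (comulL k H).dualMap ∘ₗ TensorProduct.dualDistrib k H H

/-- The element `(x¹ ⇀ ξ) ∗ (x² a₁ ⇀ ν) ⊗ x³ a₂ b` of `H* ⊗ H`, obtained from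
`Φ⁻¹ (1 ⊗ Δ(a)) = x¹ ⊗ x² a₁ ⊗ x³ a₂`. -/
def mulElem (ξ : Module.Dual k H) (a : H) (ν : Module.Dual k H) (b : H) :
    Module.Dual k H ⊗[k] H :=
  TensorProduct.map
    (conv k H ∘ₗ TensorProduct.map (hit k H ξ) (hit k H ν))
    (LinearMap.mulRight k b)
    (PhiInv k H *
      (TensorProduct.assoc k H H H).symm ((1 : H) ⊗ₜ[k] comulL k H a))

theorem mulElem_add_fst (ξ ξ' : Module.Dual k H) (a : H) (ν : Module.Dual k H) (b : H) :
    mulElem k H (ξ + ξ') a ν b = mulElem k H ξ a ν b + mulElem k H ξ' a ν b := by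
  simp only [mulElem, hit_add, TensorProduct.map_add_left, LinearMap.comp_add, LinearMap.add_apply]

theorem mulElem_smul_fst (c : k) (ξ : Module.Dual k H) (a : H) (ν : Module.Dual k H) (b : H) :
    mulElem k H (c • ξ) a ν b = c • mulElem k H ξ a ν b := by
  simp only [mulElem, hit_smul, TensorProduct.map_smul_left, LinearMap.comp_smul,
    LinearMap.smul_apply]

theorem mulElem_add_snd (ξ : Module.Dual k H) (a a' : H) (ν : Module.Dual k H) (b : H) :
    mulElem k H ξ (a + a') ν b = mulElem k H ξ a ν b + mulElem k H ξ a' ν b := by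
  simp only [mulElem, map_add, TensorProduct.tmul_add, mul_add]

theorem mulElem_smul_snd (c : k) (ξ : Module.Dual k H) (a : H) (ν : Module.Dual k H) (b : H) :
    mulElem k H ξ (c • a) ν b = c • mulElem k H ξ a ν b := by
  simp only [mulElem, map_smul, TensorProduct.tmul_smul, mul_smul_comm]

theorem mulElem_add_trd (ξ : Module.Dual k H) (a : H) (ν ν' : Module.Dual k H) (b : H) :
    mulElem k H ξ a (ν + ν') b = mulElem k H ξ a ν b + mulElem k H ξ a ν' b := by
  simp only [mulElem, hit_add, TensorProduct.map_add_right, LinearMap.comp_add,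
    TensorProduct.map_add_left, LinearMap.add_apply]

theorem mulElem_smul_trd (c : k) (ξ : Module.Dual k H) (a : H) (ν : Module.Dual k H) (b : H) :
    mulElem k H ξ a (c • ν) b = c • mulElem k H ξ a ν b := by
  simp only [mulElem, hit_smul, TensorProduct.map_smul_right, LinearMap.comp_smul,
    TensorProduct.map_smul_left, LinearMap.smul_apply]

theorem mulElem_add_fth (ξ : Module.Dual k H) (a : H) (ν : Module.Dual k H) (b b' : H) :
    mulElem k H ξ a ν (b + b') = mulElem k H ξ a ν b + mulElem k H ξ a ν b' := by
  simp only [mulElem, mulRight_add, TensorProduct.map_add_right, LinearMap.add_apply]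

theorem mulElem_smul_fth (c : k) (ξ : Module.Dual k H) (a : H) (ν : Module.Dual k H) (b : H) :
    mulElem k H ξ a ν (c • b) = c • mulElem k H ξ a ν b := by
  simp only [mulElem, mulRight_smul, TensorProduct.map_smul_right, LinearMap.smul_apply]

/-- The linear map `ν ⊗ b ↦ mulElem ξ a ν b`. -/
def mulRightLin (ξ : Module.Dual k H) (a : H) :
    Module.Dual k H ⊗[k] H →ₗ[k] Module.Dual k H ⊗[k] H :=
  TensorProduct.lift (LinearMap.mk₂ k (mulElem k H ξ a)
    (mulElem_add_trd k H ξ a) (fun c ν b => mulElem_smul_trd k H c ξ a ν b)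
    (mulElem_add_fth k H ξ a) (fun c ν b => mulElem_smul_fth k H c ξ a ν b))

theorem mulRightLin_tmul (ξ : Module.Dual k H) (a : H) (ν : Module.Dual k H) (b : H) :
    mulRightLin k H ξ a (ν ⊗ₜ[k] b) = mulElem k H ξ a ν b := by
  rw [mulRightLin, TensorProduct.lift.tmul, LinearMap.mk₂_apply]

/-- The bilinear extension of `mulElem` to `H* ⊗ H`. -/
def mulBilin : Module.Dual k H ⊗[k] H →ₗ[k] Module.Dual k H ⊗[k] H →ₗ[k]
    Module.Dual k H ⊗[k] H :=
  TensorProduct.lift (LinearMap.mk₂ k (mulRightLin k H)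
    (fun ξ ξ' a => TensorProduct.ext' fun ν b => by
      simp only [LinearMap.add_apply, mulRightLin_tmul, mulElem_add_fst])
    (fun c ξ a => TensorProduct.ext' fun ν b => by
      simp only [LinearMap.smul_apply, mulRightLin_tmul, mulElem_smul_fst])
    (fun ξ a a' => TensorProduct.ext' fun ν b => by
      simp only [LinearMap.add_apply, mulRightLin_tmul, mulElem_add_snd])
    (fun c ξ a => TensorProduct.ext' fun ν b => by
      simp only [LinearMap.smul_apply, mulRightLin_tmul, mulElem_smul_snd]))

theorem mulBilin_tmul (ξ : Module.Dual k H) (a : H) (ν : Module.Dual k H) (b : H) :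
    mulBilin k H (ξ ⊗ₜ[k] a) (ν ⊗ₜ[k] b) = mulElem k H ξ a ν b := by
  rw [mulBilin, TensorProduct.lift.tmul, LinearMap.mk₂_apply, mulRightLin_tmul]

end Double

end QuasiHopf

/-- The underlying space `H* ⊗ H` of the first Heisenberg double `ℋ₁(H*)`. It is a separate type,
so that its product is the one below and not that of a tensor product of algebras. -/
def HeisenbergDouble (k H : Type*) [Field k] [Ring H] [Algebra k H] : Type _ :=
  Module.Dual k H ⊗[k] H

namespace HeisenbergDouble

section Basic

variable (k H : Type*) [Field k] [Ring H] [Algebra k H]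

instance instAddCommGroup : AddCommGroup (HeisenbergDouble k H) :=
  inferInstanceAs (AddCommGroup (Module.Dual k H ⊗[k] H))

instance instModule : Module k (HeisenbergDouble k H) :=
  inferInstanceAs (Module k (Module.Dual k H ⊗[k] H))

variable {k H}

/-- The element `ξ # a` of `ℋ₁(H*)`. -/
def mk (ξ : Module.Dual k H) (a : H) : HeisenbergDouble k H := ξ ⊗ₜ[k] a

/-- For fixed `ξ`, the linear map `a ↦ ξ # a`. -/
def mkLin (ξ : Module.Dual k H) : H →ₗ[k] HeisenbergDouble k H where
  toFun := mk ξ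
  map_add' a b := TensorProduct.tmul_add ξ a b
  map_smul' c a := TensorProduct.tmul_smul c ξ a

variable [QuasiBialgebra k H]

/-- The (in general nonassociative) product
`(ξ # a)(ν # b) = (x¹ ⇀ ξ) ∗ (x² a₁ ⇀ ν) # x³ a₂ b`. -/
instance instNonUnitalNonAssocRing : NonUnitalNonAssocRing (HeisenbergDouble k H) :=
  { instAddCommGroup k H with
    mul := fun x y => QuasiHopf.mulBilin k H x y
    left_distrib := fun x y z => map_add (QuasiHopf.mulBilin k H x) y z
    right_distrib := fun x y z => LinearMap.map_add₂ (QuasiHopf.mulBilin k H) x y z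
    zero_mul := fun x => LinearMap.map_zero₂ (QuasiHopf.mulBilin k H) x
    mul_zero := fun x => map_zero (QuasiHopf.mulBilin k H x) }

instance instSMulCommClass : SMulCommClass k (HeisenbergDouble k H) (HeisenbergDouble k H) :=
  ⟨fun c x y => (map_smul (QuasiHopf.mulBilin k H x) c y).symm⟩

instance instIsScalarTower : IsScalarTower k (HeisenbergDouble k H) (HeisenbergDouble k H) :=
  ⟨fun c x y => LinearMap.map_smul₂ (QuasiHopf.mulBilin k H) c x y⟩

theorem mk_mul_mk (ξ : Module.Dual k H) (a : H) (ν : Module.Dual k H) (b : H) :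
    mk ξ a * mk ν b = (QuasiHopf.mulElem k H ξ a ν b : Module.Dual k H ⊗[k] H) :=
  QuasiHopf.mulBilin_tmul k H ξ a ν b

end Basic

section Elements

variable (k : Type*) {H : Type*} [Field k] [Ring H] [Algebra k H]

/-- The linear map `a ↦ ε # a`. -/
def epsMk [QuasiBialgebra k H] : H →ₗ[k] HeisenbergDouble k H :=
  mkLin (QuasiHopf.eps k H)

theorem epsMk_apply [QuasiBialgebra k H] (a : H) : epsMk k a = mk (QuasiHopf.eps k H) a := rfl

variable {k}

/-- For `w ∈ ℋ₁(H*) ⊗ ℋ₁(H*)`, the element `w₁₂ = w ⊗ (ε # 1)`. -/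
def leg12 [QuasiBialgebra k H] (w : HeisenbergDouble k H ⊗[k] HeisenbergDouble k H) :
    (HeisenbergDouble k H ⊗[k] HeisenbergDouble k H) ⊗[k] HeisenbergDouble k H :=
  w ⊗ₜ[k] epsMk k (1 : H)

/-- For `w ∈ ℋ₁(H*) ⊗ ℋ₁(H*)`, the element `w₂₃ = (ε # 1) ⊗ w`. -/
def leg23 [QuasiBialgebra k H] (w : HeisenbergDouble k H ⊗[k] HeisenbergDouble k H) :
    (HeisenbergDouble k H ⊗[k] HeisenbergDouble k H) ⊗[k] HeisenbergDouble k H :=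
  (TensorProduct.assoc k (HeisenbergDouble k H) (HeisenbergDouble k H)
    (HeisenbergDouble k H)).symm (epsMk k (1 : H) ⊗ₜ[k] w)

/-- For `w ∈ ℋ₁(H*) ⊗ ℋ₁(H*)`, the element `w₁₃`, where `(x ⊗ y)₁₃ = x ⊗ (ε # 1) ⊗ y`. -/
def leg13 [QuasiBialgebra k H] (w : HeisenbergDouble k H ⊗[k] HeisenbergDouble k H) :
    (HeisenbergDouble k H ⊗[k] HeisenbergDouble k H) ⊗[k] HeisenbergDouble k H :=
  TensorProduct.map
    ((TensorProduct.mk k (HeisenbergDouble k H) (HeisenbergDouble k H)).flip (epsMk k (1 : H)))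
    LinearMap.id w

/-- The canonical element `W = ∑ᵢ (ε # eᵢ) ⊗ (eⁱ # 1)` for a basis `e`. -/
def W [QuasiBialgebra k H] {I : Type*} [Fintype I] (e : Module.Basis I k H) :
    HeisenbergDouble k H ⊗[k] HeisenbergDouble k H :=
  ∑ i, epsMk k (e i) ⊗ₜ[k] mk (e.coord i) (1 : H)

/-- The quasi-inverse `W̃ = ∑ᵢ (ε # S(eᵢ U¹)) ⊗ (eⁱ # U²)` for a basis `e`. -/
def Wtilde [QuasiHopfAlgebra k H] {I : Type*} [Fintype I] (e : Module.Basis I k H) :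
    HeisenbergDouble k H ⊗[k] HeisenbergDouble k H :=
  ∑ i, TensorProduct.map
    (epsMk k ∘ₗ QuasiHopf.S k H ∘ₗ LinearMap.mulLeft k (e i))
    (mkLin (e.coord i))
    (QuasiHopf.U k H)

variable (k H)

/-- `𝚽⁻¹ = (ε # x¹) ⊗ (ε # x²) ⊗ (ε # x³)`. -/
def PhiInvBold [QuasiBialgebra k H] :
    (HeisenbergDouble k H ⊗[k] HeisenbergDouble k H) ⊗[k] HeisenbergDouble k H :=
  TensorProduct.map (TensorProduct.map (epsMk k) (epsMk k)) (epsMk k) (QuasiHopf.PhiInv k H)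

/-- `𝚽³²¹_S = (ε # S(X³)) ⊗ (ε # S(X²)) ⊗ (ε # S(X¹))`. -/
def Phi321S [QuasiHopfAlgebra k H] :
    (HeisenbergDouble k H ⊗[k] HeisenbergDouble k H) ⊗[k] HeisenbergDouble k H :=
  (TensorProduct.assoc k (HeisenbergDouble k H) (HeisenbergDouble k H)
    (HeisenbergDouble k H)).symm
    (TensorProduct.map (epsMk k ∘ₗ QuasiHopf.S k H)
      (TensorProduct.map (epsMk k ∘ₗ QuasiHopf.S k H) (epsMk k ∘ₗ QuasiHopf.S k H) ∘ₗ
        (TensorProduct.comm k H H).toLinearMap)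
      (TensorProduct.comm k (H ⊗[k] H) H (QuasiHopf.Phi k H)))

end Elements

end HeisenbergDouble

end

noncomputable section

set_option maxSynthPendingDepth 3
set_option linter.unusedSectionVars false

namespace QuasiHopf

/-! ### Reduction to pure tensors. -/

section Multilinear

variable {k H A : Type*} [Field k] [Ring H] [Algebra k H] [AddCommGroup A] [Module k A]

/-! The dual bases turn both equations into identities in tensor powers of H. In the double, ε # 1
is a two-sided unit and the elements ε # a multiply as in H. In each leg of the four triple products
either one factor is the unit or both outer factors are of the form ε # a, so `epsMk_mul_mul_epsMk`
is all that bracketing requires. `sum_tmul_hitMk` trades an action on eⁱ for a right multiplication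
of eᵢ, and `sum_tmul_convMk` trades the convolution of eˡ and eʲ for a coproduct Δ(eₘ). After this,
both sides of the quasi-pentagon equation are literally the same sum.

For W̃ the same reduction leaves one identity about U, `PhiInv_mul_comulSnd_uElt`. It is accessible
because U = Δ(S(x¹) α x²) p (1 ⊗ S(x³)) with p = x¹ ⊗ x² β S(x³) (`U_eq`, `twistInv_mul_qElt`), a
formula free of g and S⁻¹.

All identities in H ⊗ H come from one method: apply a linear map built from caps S(a) α b and cups a
β S(b) to a rearranged pentagon or to quasi-coassociativity. A cap absorbs a coproduct on its left,
a cup one on its right, and since ε in any slot sends Φ and Φ⁻¹ to 1, the corresponding factor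
disappears. Write Δ₁, Δ₂, Δ₃ for Δ applied in the first, second, third slot of a triple tensor, and
Q = S(X²) α X³ ⊗ S(X¹). The method yields g Q = U, g (S ⊗ S)Δᶜᵒᵖ(h) = Δ(S(h)) g and g γ = Δ(α),
hence gf = 1; finite dimension gives fg = 1.

Bijectivity of S uses a different idea: two algebra maps out of H that agree on the image of S are
equal (`algHom_eq_of_comp_S`). Applied to the Fitting projection of a high power of S², this forces
that power to be surjective. -/

theorem tensor_induction₃ {p : (H ⊗[k] H) ⊗[k] H → Prop} (zero : p 0)
    (tmul : ∀ a b c, p ((a ⊗ₜ b) ⊗ₜ c)) (add : ∀ x y, p x → p y → p (x + y)) (t) : p t := by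
  induction t using TensorProduct.induction_on with
  | zero => exact zero
  | add x y hx hy => exact add x y hx hy
  | tmul s c =>
    induction s using TensorProduct.induction_on with
    | zero => simpa using zero
    | tmul a b => exact tmul a b c
    | add x y hx hy => rw [TensorProduct.add_tmul]; exact add _ _ hx hy

theorem tensor_induction₄ {p : ((H ⊗[k] H) ⊗[k] H) ⊗[k] H → Prop} (zero : p 0)
    (tmul : ∀ a b c d, p (((a ⊗ₜ b) ⊗ₜ c) ⊗ₜ d)) (add : ∀ x y, p x → p y → p (x + y)) (t) :
    p t := by
  induction t using TensorProduct.induction_on with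
  | zero => exact zero
  | add x y hx hy => exact add x y hx hy
  | tmul s d =>
    induction s using tensor_induction₃ with
    | zero => simpa using zero
    | tmul a b c => exact tmul a b c d
    | add x y hx hy => rw [TensorProduct.add_tmul]; exact add _ _ hx hy

end Multilinear

/-! ### Forms of the pentagon, and counits of the associator. -/

section Bialgebra

variable (k H : Type*) [Field k] [Ring H] [Algebra k H] [QuasiBialgebra k H]

/-- The coproduct. -/
abbrev comul : H →ₐ[k] H ⊗[k] H := QuasiBialgebra.comul

/-- The counit. -/
abbrev counit : H →ₐ[k] k := QuasiBialgebra.counit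

@[simp] theorem comulL_apply (h : H) : comulL k H h = comul k H h := rfl

/-- `Δ ⊗ id`. -/
def comulFst : H ⊗[k] H →ₐ[k] (H ⊗[k] H) ⊗[k] H :=
  Algebra.TensorProduct.map (comul k H) (AlgHom.id k H)

/-- `id ⊗ Δ`. -/
def comulSnd : H ⊗[k] H →ₐ[k] (H ⊗[k] H) ⊗[k] H :=
  (Algebra.TensorProduct.assoc k k k H H H).symm.toAlgHom.comp
    (Algebra.TensorProduct.map (AlgHom.id k H) (comul k H))

/-- `Δ ⊗ id ⊗ id`. -/
def comul₁ : (H ⊗[k] H) ⊗[k] H →ₐ[k] ((H ⊗[k] H) ⊗[k] H) ⊗[k] H :=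
  Algebra.TensorProduct.map (comulFst k H) (AlgHom.id k H)

/-- `id ⊗ Δ ⊗ id`. -/
def comul₂ : (H ⊗[k] H) ⊗[k] H →ₐ[k] ((H ⊗[k] H) ⊗[k] H) ⊗[k] H :=
  Algebra.TensorProduct.map (comulSnd k H) (AlgHom.id k H)

/-- `id ⊗ id ⊗ Δ`. -/
def comul₃ : (H ⊗[k] H) ⊗[k] H →ₐ[k] ((H ⊗[k] H) ⊗[k] H) ⊗[k] H :=
  (Algebra.TensorProduct.assoc k k k (H ⊗[k] H) H H).symm.toAlgHom.comp
    (Algebra.TensorProduct.map (AlgHom.id k (H ⊗[k] H)) (comul k H))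

/-- `t ↦ 1 ⊗ t`. -/
def one_tmul : (H ⊗[k] H) ⊗[k] H →ₐ[k] ((H ⊗[k] H) ⊗[k] H) ⊗[k] H :=
  Algebra.TensorProduct.map
    (Algebra.TensorProduct.map Algebra.TensorProduct.includeRight (AlgHom.id k H)) (AlgHom.id k H)

/-- `t ↦ t ⊗ 1`. -/
def tmul_one : (H ⊗[k] H) ⊗[k] H →ₐ[k] ((H ⊗[k] H) ⊗[k] H) ⊗[k] H :=
  Algebra.TensorProduct.includeLeft

@[simp] theorem comulFst_tmul (a b : H) : comulFst k H (a ⊗ₜ b) = comul k H a ⊗ₜ b := rfl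

@[simp] theorem comulSnd_tmul (a b : H) : comulSnd k H (a ⊗ₜ b) =
    (TensorProduct.assoc k H H H).symm (a ⊗ₜ comul k H b) := rfl

@[simp] theorem comul₁_tmul (a b c : H) :
    comul₁ k H ((a ⊗ₜ b) ⊗ₜ c) = (comul k H a ⊗ₜ b) ⊗ₜ c := rfl

@[simp] theorem comul₂_tmul (a b c : H) : comul₂ k H ((a ⊗ₜ b) ⊗ₜ c) =
    (TensorProduct.assoc k H H H).symm (a ⊗ₜ comul k H b) ⊗ₜ c := rfl

@[simp] theorem comul₃_tmul (s : H ⊗[k] H) (c : H) : comul₃ k H (s ⊗ₜ c) =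
    (TensorProduct.assoc k (H ⊗[k] H) H H).symm (s ⊗ₜ comul k H c) := rfl

@[simp] theorem one_tmul_tmul (a b c : H) :
    one_tmul k H ((a ⊗ₜ b) ⊗ₜ c) = ((1 ⊗ₜ a) ⊗ₜ b) ⊗ₜ c := rfl

@[simp] theorem tmul_one_apply (t : (H ⊗[k] H) ⊗[k] H) : tmul_one k H t = t ⊗ₜ 1 := rfl

@[simp] theorem Phi_mul_PhiInv : Phi k H * PhiInv k H = 1 := Units.mul_inv _
@[simp] theorem PhiInv_mul_Phi : PhiInv k H * Phi k H = 1 := Units.inv_mul _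

theorem comulSnd_comul (h : H) :
    comulSnd k H (comul k H h) = Phi k H * comulFst k H (comul k H h) * PhiInv k H :=
  QuasiBialgebra.quasi_coassoc h

theorem comulSnd_comul_mul (h : H) :
    comulSnd k H (comul k H h) * Phi k H = Phi k H * comulFst k H (comul k H h) := by
  rw [comulSnd_comul, mul_assoc, PhiInv_mul_Phi, mul_one]

theorem PhiInv_mul_comulSnd_comul (h : H) :
    PhiInv k H * comulSnd k H (comul k H h) = comulFst k H (comul k H h) * PhiInv k H := by
  rw [comulSnd_comul, ← mul_assoc, ← mul_assoc, PhiInv_mul_Phi, one_mul]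

/-- `Φ` as a unit. -/
abbrev PhiUnit : ((H ⊗[k] H) ⊗[k] H)ˣ := QuasiBialgebra.assoc

theorem pentagon : one_tmul k H (Phi k H) * comul₂ k H (Phi k H) * tmul_one k H (Phi k H) =
    comul₃ k H (Phi k H) * comul₁ k H (Phi k H) :=
  QuasiBialgebra.pentagon

/-- The pentagon in the group of units. -/
theorem pentagon_units :
    Units.map (MonoidHomClass.toMonoidHom (one_tmul k H)) (PhiUnit k H) *
      Units.map (MonoidHomClass.toMonoidHom (comul₂ k H)) (PhiUnit k H) *
      Units.map (MonoidHomClass.toMonoidHom (tmul_one k H)) (PhiUnit k H) =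
    Units.map (MonoidHomClass.toMonoidHom (comul₃ k H)) (PhiUnit k H) *
      Units.map (MonoidHomClass.toMonoidHom (comul₁ k H)) (PhiUnit k H) :=
  Units.ext (pentagon k H)

/-- Arranged so that Δ₃ is leftmost and Δ₂ rightmost: a cap on slots 3, 4 then absorbs the former
and a cup on slots 2, 3 the latter. -/
theorem comul₁_mul_PhiInv : comul₁ k H (Phi k H) * tmul_one k H (PhiInv k H) =
    comul₃ k H (PhiInv k H) * (one_tmul k H (Phi k H) * comul₂ k H (Phi k H)) := by
  have h := pentagon_units k H
  have h' : Units.map (MonoidHomClass.toMonoidHom (comul₁ k H)) (PhiUnit k H) *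
      (Units.map (MonoidHomClass.toMonoidHom (tmul_one k H)) (PhiUnit k H))⁻¹ =
      (Units.map (MonoidHomClass.toMonoidHom (comul₃ k H)) (PhiUnit k H))⁻¹ *
      (Units.map (MonoidHomClass.toMonoidHom (one_tmul k H)) (PhiUnit k H) *
        Units.map (MonoidHomClass.toMonoidHom (comul₂ k H)) (PhiUnit k H)) := by
    rw [eq_inv_mul_iff_mul_eq, ← mul_assoc, ← h, mul_inv_cancel_right]
  exact congrArg Units.val h'

theorem comul₃_inv_mul_one_tmul : comul₃ k H (PhiInv k H) * one_tmul k H (Phi k H) =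
    comul₁ k H (Phi k H) * (tmul_one k H (PhiInv k H) * comul₂ k H (PhiInv k H)) := by
  have h := pentagon_units k H
  have h' : (Units.map (MonoidHomClass.toMonoidHom (comul₃ k H)) (PhiUnit k H))⁻¹ *
      Units.map (MonoidHomClass.toMonoidHom (one_tmul k H)) (PhiUnit k H) =
      Units.map (MonoidHomClass.toMonoidHom (comul₁ k H)) (PhiUnit k H) *
      ((Units.map (MonoidHomClass.toMonoidHom (tmul_one k H)) (PhiUnit k H))⁻¹ *
        (Units.map (MonoidHomClass.toMonoidHom (comul₂ k H)) (PhiUnit k H))⁻¹) := by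
    rw [inv_mul_eq_iff_eq_mul, ← mul_assoc, ← h]; group
  exact congrArg Units.val h'

theorem pentagon_inv :
    tmul_one k H (PhiInv k H) * (comul₂ k H (PhiInv k H) * one_tmul k H (PhiInv k H)) =
    comul₁ k H (PhiInv k H) * comul₃ k H (PhiInv k H) := by
  have h := congrArg (fun u => u⁻¹) (pentagon_units k H)
  simp only [mul_inv_rev] at h
  exact congrArg Units.val h

theorem tmul_one_mul_comul₂ : tmul_one k H (PhiInv k H) * comul₂ k H (PhiInv k H) =
    comul₁ k H (PhiInv k H) * (comul₃ k H (PhiInv k H) * one_tmul k H (Phi k H)) := by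
  rw [← mul_assoc, ← pentagon_inv, mul_assoc, mul_assoc, ← map_mul, PhiInv_mul_Phi, map_one,
    mul_one]

theorem comul₁_PhiInv : comul₁ k H (PhiInv k H) =
    tmul_one k H (PhiInv k H) * (comul₂ k H (PhiInv k H) *
      (one_tmul k H (PhiInv k H) * comul₃ k H (Phi k H))) := by
  have := pentagon_inv k H
  rw [← mul_assoc (comul₂ k H _), ← mul_assoc, this, mul_assoc, ← map_mul, PhiInv_mul_Phi,
    map_one, mul_one]

/-- `ε ⊗ id ⊗ id`. -/
def counit₁ : (H ⊗[k] H) ⊗[k] H →ₐ[k] H ⊗[k] H :=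
  Algebra.TensorProduct.map ((Algebra.TensorProduct.lid k H).toAlgHom.comp
    (Algebra.TensorProduct.map (counit k H) (AlgHom.id k H))) (AlgHom.id k H)

/-- `id ⊗ ε ⊗ id`. -/
def counit₂ : (H ⊗[k] H) ⊗[k] H →ₐ[k] H ⊗[k] H :=
  Algebra.TensorProduct.map ((Algebra.TensorProduct.rid k k H).toAlgHom.comp
    (Algebra.TensorProduct.map (AlgHom.id k H) (counit k H))) (AlgHom.id k H)

/-- `id ⊗ id ⊗ ε`. -/
def counit₃ : (H ⊗[k] H) ⊗[k] H →ₐ[k] H ⊗[k] H :=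
  (Algebra.TensorProduct.rid k k (H ⊗[k] H)).toAlgHom.comp
    (Algebra.TensorProduct.map (AlgHom.id k (H ⊗[k] H)) (counit k H))

@[simp] theorem counit₁_tmul (a b c : H) :
    counit₁ k H ((a ⊗ₜ b) ⊗ₜ c) = (counit k H a • b) ⊗ₜ c := rfl

@[simp] theorem counit₂_tmul (a b c : H) :
    counit₂ k H ((a ⊗ₜ b) ⊗ₜ c) = (counit k H b • a) ⊗ₜ c := rfl

@[simp] theorem counit₃_tmul (s : H ⊗[k] H) (c : H) :
    counit₃ k H (s ⊗ₜ c) = counit k H c • s := rfl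

@[simp] theorem counit₂_Phi : counit₂ k H (Phi k H) = 1 := QuasiBialgebra.assoc_counit

theorem counit_smul_comul_right (h : H) :
    Algebra.TensorProduct.rid k k H (Algebra.TensorProduct.map (AlgHom.id k H) (counit k H)
      (comul k H h)) = h := QuasiBialgebra.counit_right h

theorem counit_smul_comul_left (h : H) :
    Algebra.TensorProduct.lid k H (Algebra.TensorProduct.map (counit k H) (AlgHom.id k H)
      (comul k H h)) = h := QuasiBialgebra.counit_left h

-- Applying id ⊗ ε ⊗ id ⊗ id to the pentagon leaves (1 ⊗ (ε ⊗ id ⊗ id)(Φ)) Φ = Φ, where Φ cancels.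
@[simp] theorem counit₁_Phi : counit₁ k H (Phi k H) = 1 := by
  have h := congrArg (Algebra.TensorProduct.map (counit₂ k H) (AlgHom.id k H)) (pentagon k H)
  simp only [map_mul] at h
  have h₁ : ∀ y, Algebra.TensorProduct.map (counit₂ k H) (AlgHom.id k H) (one_tmul k H y) =
      (TensorProduct.assoc k H H H).symm (1 ⊗ₜ counit₁ k H y) := by
    intro y
    induction y using tensor_induction₃ with
    | zero => simp
    | tmul a b c => simp [TensorProduct.smul_tmul]
    | add x y hx hy => simp only [map_add, hx, hy, TensorProduct.tmul_add]
  have h₂ : ∀ y, Algebra.TensorProduct.map (counit₂ k H) (AlgHom.id k H) (comul₂ k H y) = y := by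
    intro y
    induction y using tensor_induction₃ with
    | zero => simp
    | tmul a b c =>
      conv_rhs => rw [← counit_smul_comul_left k H b]
      rw [comul₂_tmul]
      generalize comul k H b = z
      induction z using TensorProduct.induction_on with
      | zero => simp
      | tmul a b => simp [TensorProduct.smul_tmul]
      | add x y hx hy =>
        simp only [map_add, hx, hy, TensorProduct.tmul_add, TensorProduct.add_tmul]
    | add x y hx hy => simp only [map_add, hx, hy]
  have h₃ : ∀ y, Algebra.TensorProduct.map (counit₂ k H) (AlgHom.id k H) (tmul_one k H y) =
      counit₂ k H y ⊗ₜ 1 := fun y => rfl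
  have h₄ : ∀ y, Algebra.TensorProduct.map (counit₂ k H) (AlgHom.id k H) (comul₃ k H y) =
      comulSnd k H (counit₂ k H y) := by
    intro y
    induction y using tensor_induction₃ with
    | zero => simp
    | tmul a b c =>
      simp only [comul₃_tmul, counit₂_tmul, comulSnd_tmul]
      generalize comul k H c = z
      induction z using TensorProduct.induction_on with
      | zero => simp
      | tmul a b => simp
      | add x y hx hy =>
        simp only [map_add, hx, hy, TensorProduct.tmul_add]
    | add x y hx hy => simp only [map_add, hx, hy]
  have h₅ : ∀ y, Algebra.TensorProduct.map (counit₂ k H) (AlgHom.id k H) (comul₁ k H y) = y := by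
    intro y
    induction y using tensor_induction₃ with
    | zero => simp
    | tmul a b c =>
      conv_rhs => rw [← counit_smul_comul_right k H a]
      rw [comul₁_tmul]
      generalize comul k H a = z
      induction z using TensorProduct.induction_on with
      | zero => simp
      | tmul a b => simp
      | add x y hx hy =>
        simp only [map_add, hx, hy, TensorProduct.add_tmul]
    | add x y hx hy => simp only [map_add, hx, hy]
  rw [h₁, h₂, h₃, h₄, h₅, counit₂_Phi, map_one, one_mul] at h
  have h' := congrArg (· * PhiInv k H) h
  simp only [← Algebra.TensorProduct.one_def, mul_one, mul_assoc, Phi_mul_PhiInv] at h'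
  have h'' := congrArg (fun t => counit₁ k H t) h'
  have h₆ : ∀ z : H ⊗[k] H, counit₁ k H ((TensorProduct.assoc k H H H).symm (1 ⊗ₜ z)) = z := by
    intro z
    induction z using TensorProduct.induction_on with
    | zero => simp
    | tmul a b => simp
    | add x y hx hy => simp only [map_add, hx, hy, TensorProduct.tmul_add]
  simpa [h₆] using h''

-- With ε in the third of the four slots the pentagon reduces to Φ ((id ⊗ id ⊗ ε)(Φ) ⊗ 1) = Φ.
@[simp] theorem counit₃_Phi : counit₃ k H (Phi k H) = 1 := by
  have h := congrArg (Algebra.TensorProduct.map (counit₃ k H) (AlgHom.id k H)) (pentagon k H)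
  simp only [map_mul] at h
  have h₁ : ∀ y, Algebra.TensorProduct.map (counit₃ k H) (AlgHom.id k H) (one_tmul k H y) =
      (TensorProduct.assoc k H H H).symm (1 ⊗ₜ counit₂ k H y) := by
    intro y
    induction y using tensor_induction₃ with
    | zero => simp
    | tmul a b c => simp [TensorProduct.smul_tmul]
    | add x y hx hy => simp only [map_add, hx, hy, TensorProduct.tmul_add]
  have h₂ : ∀ y, Algebra.TensorProduct.map (counit₃ k H) (AlgHom.id k H) (comul₂ k H y) = y := by
    intro y
    induction y using tensor_induction₃ with
    | zero => simp
    | tmul a b c =>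
      conv_rhs => rw [← counit_smul_comul_right k H b]
      rw [comul₂_tmul]
      generalize comul k H b = z
      induction z using TensorProduct.induction_on with
      | zero => simp
      | tmul a b => simp
      | add x y hx hy =>
        simp only [map_add, hx, hy, TensorProduct.tmul_add, TensorProduct.add_tmul]
    | add x y hx hy => simp only [map_add, hx, hy]
  have h₃ : ∀ y, Algebra.TensorProduct.map (counit₃ k H) (AlgHom.id k H) (tmul_one k H y) =
      counit₃ k H y ⊗ₜ 1 := fun y => rfl
  have h₄ : ∀ y, Algebra.TensorProduct.map (counit₃ k H) (AlgHom.id k H) (comul₃ k H y) = y := by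
    intro y
    induction y using tensor_induction₃ with
    | zero => simp
    | tmul a b c =>
      conv_rhs => rw [← counit_smul_comul_left k H c]
      rw [comul₃_tmul]
      generalize comul k H c = z
      induction z using TensorProduct.induction_on with
      | zero => simp
      | tmul a b => simp [TensorProduct.smul_tmul]
      | add x y hx hy =>
        simp only [map_add, hx, hy, TensorProduct.tmul_add]
    | add x y hx hy => simp only [map_add, hx, hy]
  have h₅ : ∀ y, Algebra.TensorProduct.map (counit₃ k H) (AlgHom.id k H) (comul₁ k H y) =
      comulFst k H (counit₂ k H y) := by
    intro y
    induction y using tensor_induction₃ with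
    | zero => simp
    | tmul a b c => simp
    | add x y hx hy => simp only [map_add, hx, hy]
  rw [h₁, h₂, h₃, h₄, h₅, counit₂_Phi, map_one, Algebra.TensorProduct.one_def] at h
  have h₀ : (TensorProduct.assoc k H H H).symm ((1 : H) ⊗ₜ[k] ((1 : H) ⊗ₜ[k] (1 : H))) = 1 := rfl
  rw [h₀, one_mul, mul_one] at h
  have h' := congrArg (PhiInv k H * ·) h
  simp only [← mul_assoc, PhiInv_mul_Phi, one_mul] at h'
  simpa using congrArg (fun t => counit₃ k H t) h'

theorem counit₁_PhiInv : counit₁ k H (PhiInv k H) = 1 := by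
  have h := congrArg (counit₁ k H) (Phi_mul_PhiInv k H)
  rwa [map_mul, map_one, counit₁_Phi, one_mul] at h

theorem counit₂_PhiInv : counit₂ k H (PhiInv k H) = 1 := by
  have h := congrArg (counit₂ k H) (Phi_mul_PhiInv k H)
  rwa [map_mul, map_one, counit₂_Phi, one_mul] at h

theorem counit₃_PhiInv : counit₃ k H (PhiInv k H) = 1 := by
  have h := congrArg (counit₃ k H) (Phi_mul_PhiInv k H)
  rwa [map_mul, map_one, counit₃_Phi, one_mul] at h

end Bialgebra
end QuasiHopf

namespace QuasiHopf

/-! ### Linear maps that absorb a coproduct factor. -/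

section Kill

variable {k H A : Type*} [Field k] [Ring H] [Algebra k H] [QuasiBialgebra k H]
  [AddCommGroup A] [Module k A]

/-- Such a G factors through ε ⊗ id ⊗ id, which sends both Φ and Φ⁻¹ to 1. -/
theorem map_eq_of_counit_fst (G : (H ⊗[k] H) ⊗[k] H →ₗ[k] A)
    (hG : ∀ a b c, G ((a ⊗ₜ b) ⊗ₜ c) = counit k H a • G ((1 ⊗ₜ b) ⊗ₜ c)) :
    G (Phi k H) = G 1 ∧ G (PhiInv k H) = G 1 := by
  have key : ∀ y, G y = G ((TensorProduct.assoc k H H H).symm (1 ⊗ₜ counit₁ k H y)) := by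
    intro y
    induction y using tensor_induction₃ with
    | zero => simp
    | tmul a b c => simp [hG a, TensorProduct.tmul_smul, ← TensorProduct.smul_tmul']
    | add x y hx hy => simp only [map_add, hx, hy, TensorProduct.tmul_add]
  have h₀ : (TensorProduct.assoc k H H H).symm ((1 : H) ⊗ₜ[k] (1 : H ⊗[k] H)) = 1 := rfl
  constructor
  · rw [key, counit₁_Phi, h₀]
  · rw [key, counit₁_PhiInv, h₀]

theorem map_eq_of_counit_snd (G : (H ⊗[k] H) ⊗[k] H →ₗ[k] A)
    (hG : ∀ a b c, G ((a ⊗ₜ b) ⊗ₜ c) = counit k H b • G ((a ⊗ₜ 1) ⊗ₜ c)) :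
    G (Phi k H) = G 1 ∧ G (PhiInv k H) = G 1 := by
  have key : ∀ y, G y =
      G (Algebra.TensorProduct.map (Algebra.TensorProduct.includeLeft : H →ₐ[k] H ⊗[k] H)
        (AlgHom.id k H)
        (counit₂ k H y)) := by
    intro y
    induction y using tensor_induction₃ with
    | zero => simp
    | tmul a b c => simp [hG a b, ← TensorProduct.smul_tmul']
    | add x y hx hy => simp only [map_add, hx, hy]
  constructor
  · rw [key, counit₂_Phi, map_one]
  · rw [key, counit₂_PhiInv, map_one]

theorem map_eq_of_counit_trd (G : (H ⊗[k] H) ⊗[k] H →ₗ[k] A)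
    (hG : ∀ a b c, G ((a ⊗ₜ b) ⊗ₜ c) = counit k H c • G ((a ⊗ₜ b) ⊗ₜ 1)) :
    G (Phi k H) = G 1 ∧ G (PhiInv k H) = G 1 := by
  have key : ∀ y, G y = G (counit₃ k H y ⊗ₜ 1) := by
    intro y
    induction y using tensor_induction₃ with
    | zero => simp
    | tmul a b c => simp [hG a b c, ← TensorProduct.smul_tmul']
    | add x y hx hy => simp only [map_add, hx, hy, TensorProduct.add_tmul]
  constructor
  · rw [key, counit₃_Phi]; rfl
  · rw [key, counit₃_PhiInv]; rfl

theorem assoc_symm_mul (a a' : H) (s s' : H ⊗[k] H) :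
    (TensorProduct.assoc k H H H).symm (a ⊗ₜ s) * (TensorProduct.assoc k H H H).symm (a' ⊗ₜ s') =
    (TensorProduct.assoc k H H H).symm ((a * a') ⊗ₜ (s * s')) := by
  rw [← Algebra.TensorProduct.tmul_mul_tmul]
  exact (map_mul (Algebra.TensorProduct.assoc k k k H H H).symm (a ⊗ₜ[k] s) (a' ⊗ₜ[k] s')).symm

theorem assoc_symm_mul₄ (a a' : H ⊗[k] H) (s s' : H ⊗[k] H) :
    (TensorProduct.assoc k (H ⊗[k] H) H H).symm (a ⊗ₜ s) *
      (TensorProduct.assoc k (H ⊗[k] H) H H).symm (a' ⊗ₜ s') =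
    (TensorProduct.assoc k (H ⊗[k] H) H H).symm ((a * a') ⊗ₜ (s * s')) := by
  rw [← Algebra.TensorProduct.tmul_mul_tmul]
  exact (map_mul (Algebra.TensorProduct.assoc k k k (H ⊗[k] H) H H).symm
    (a ⊗ₜ[k] s) (a' ⊗ₜ[k] s')).symm

/-- This and the next three lemmas delete factors from the pentagon: F sees the doubled slot only
through ε, so the previous lemmas apply. -/
theorem map_comul₁_mul (F : ((H ⊗[k] H) ⊗[k] H) ⊗[k] H →ₗ[k] A)
    (hF : ∀ h u c d, F (((comul k H h * u) ⊗ₜ c) ⊗ₜ d) = counit k H h • F ((u ⊗ₜ c) ⊗ₜ d)) (t) :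
    F (comul₁ k H (Phi k H) * t) = F t ∧ F (comul₁ k H (PhiInv k H) * t) = F t := by
  have := map_eq_of_counit_fst (F ∘ₗ LinearMap.mulRight k t ∘ₗ (comul₁ k H).toLinearMap) ?_
  · simpa using this
  intro a b c
  induction t using tensor_induction₄ with
  | zero => simp
  | tmul x y z w => simp [hF]
  | add x y hx hy =>
    simp only [LinearMap.comp_apply, LinearMap.mulRight_apply, mul_add, map_add, smul_add]
      at hx hy ⊢
    rw [hx, hy]

theorem map_comul₃_mul (F : ((H ⊗[k] H) ⊗[k] H) ⊗[k] H →ₗ[k] A)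
    (hF : ∀ h u v, F ((TensorProduct.assoc k (H ⊗[k] H) H H).symm (u ⊗ₜ (comul k H h * v))) =
      counit k H h • F ((TensorProduct.assoc k (H ⊗[k] H) H H).symm (u ⊗ₜ v))) (t) :
    F (comul₃ k H (Phi k H) * t) = F t ∧ F (comul₃ k H (PhiInv k H) * t) = F t := by
  have := map_eq_of_counit_trd (F ∘ₗ LinearMap.mulRight k t ∘ₗ (comul₃ k H).toLinearMap) ?_
  · simpa using this
  intro a b c
  induction t using tensor_induction₄ with
  | zero => simp
  | tmul x y z w =>
    simp only [LinearMap.comp_apply, AlgHom.toLinearMap_apply, LinearMap.mulRight_apply,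
      comul₃_tmul, map_one]
    rw [← TensorProduct.assoc_symm_tmul (x ⊗ₜ[k] y) z w, assoc_symm_mul₄, assoc_symm_mul₄, hF,
      one_mul]
  | add x y hx hy =>
    simp only [LinearMap.comp_apply, LinearMap.mulRight_apply, mul_add, map_add, smul_add]
      at hx hy ⊢
    rw [hx, hy]

theorem map_mul_comul₃ (F : ((H ⊗[k] H) ⊗[k] H) ⊗[k] H →ₗ[k] A)
    (hF : ∀ h u v, F ((TensorProduct.assoc k (H ⊗[k] H) H H).symm (u ⊗ₜ (v * comul k H h))) =
      counit k H h • F ((TensorProduct.assoc k (H ⊗[k] H) H H).symm (u ⊗ₜ v))) (t) :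
    F (t * comul₃ k H (Phi k H)) = F t ∧ F (t * comul₃ k H (PhiInv k H)) = F t := by
  have := map_eq_of_counit_trd (F ∘ₗ LinearMap.mulLeft k t ∘ₗ (comul₃ k H).toLinearMap) ?_
  · simpa using this
  intro a b c
  induction t using tensor_induction₄ with
  | zero => simp
  | tmul x y z w =>
    simp only [LinearMap.comp_apply, AlgHom.toLinearMap_apply, LinearMap.mulLeft_apply,
      comul₃_tmul, map_one]
    rw [← TensorProduct.assoc_symm_tmul (x ⊗ₜ[k] y) z w, assoc_symm_mul₄, assoc_symm_mul₄, hF,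
      mul_one]
  | add x y hx hy =>
    simp only [LinearMap.comp_apply, LinearMap.mulLeft_apply, add_mul, map_add, smul_add]
      at hx hy ⊢
    rw [hx, hy]

theorem map_mul_comul₂ (F : ((H ⊗[k] H) ⊗[k] H) ⊗[k] H →ₗ[k] A)
    (hF : ∀ h a v d, F ((TensorProduct.assoc k H H H).symm (a ⊗ₜ (v * comul k H h)) ⊗ₜ d) =
      counit k H h • F ((TensorProduct.assoc k H H H).symm (a ⊗ₜ v) ⊗ₜ d)) (t) :
    F (t * comul₂ k H (Phi k H)) = F t ∧ F (t * comul₂ k H (PhiInv k H)) = F t := by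
  have := map_eq_of_counit_snd (F ∘ₗ LinearMap.mulLeft k t ∘ₗ (comul₂ k H).toLinearMap) ?_
  · simpa using this
  intro a b c
  induction t using tensor_induction₄ with
  | zero => simp
  | tmul x y z w =>
    simp only [LinearMap.comp_apply, AlgHom.toLinearMap_apply, LinearMap.mulLeft_apply,
      comul₂_tmul, map_one, Algebra.TensorProduct.tmul_mul_tmul]
    rw [← TensorProduct.assoc_symm_tmul x y z, assoc_symm_mul, assoc_symm_mul, hF, mul_one]
  | add x y hx hy =>
    simp only [LinearMap.comp_apply, LinearMap.mulLeft_apply, add_mul, map_add, smul_add]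
      at hx hy ⊢
    rw [hx, hy]

end Kill

/-! ### Caps, cups, and the elements p and Q. -/

section Hopf

variable (k H : Type*) [Field k] [Ring H] [Algebra k H] [QuasiHopfAlgebra k H]

@[simp] theorem S_one : S k H 1 = 1 := QuasiHopfAlgebra.antipode_one
@[simp] theorem S_mul (a b : H) : S k H (a * b) = S k H b * S k H a :=
  QuasiHopfAlgebra.antipode_mul a b

@[simp] theorem cap_tmul (a b : H) : cap k H (a ⊗ₜ b) = S k H a * (α k H * b) := capMap_tmul _ _ _ _
@[simp] theorem cup_tmul (a b : H) : cup k H (a ⊗ₜ b) = a * (β k H * S k H b) := by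
  rw [cupMap_tmul, mul_assoc]

theorem cap_comul (h : H) : cap k H (comul k H h) = counit k H h • α k H :=
  QuasiHopfAlgebra.antipode_alpha h
theorem cup_comul (h : H) : cup k H (comul k H h) = counit k H h • β k H :=
  QuasiHopfAlgebra.antipode_beta h

theorem cap_mul_tmul (s : H ⊗[k] H) (a b : H) :
    cap k H (s * (a ⊗ₜ b)) = S k H a * (cap k H s * b) := by
  induction s using TensorProduct.induction_on with
  | zero => simp
  | tmul x y => simp [mul_assoc]
  | add x y hx hy => simp only [add_mul, mul_add, map_add, hx, hy]

theorem cup_tmul_mul (a b : H) (s : H ⊗[k] H) :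
    cup k H ((a ⊗ₜ b) * s) = a * (cup k H s * S k H b) := by
  induction s using TensorProduct.induction_on with
  | zero => simp
  | tmul x y => simp [mul_assoc]
  | add x y hx hy => simp only [add_mul, mul_add, map_add, hx, hy]

/-- As S reverses products, S(h₁) α h₂ appears in the middle of the expression. -/
theorem cap_comul_mul (h : H) (s : H ⊗[k] H) :
    cap k H (comul k H h * s) = counit k H h • cap k H s := by
  induction s using TensorProduct.induction_on with
  | zero => simp
  | tmul x y => simp [cap_mul_tmul, cap_comul]
  | add x y hx hy => simp only [mul_add, map_add, hx, hy, smul_add]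

theorem cup_mul_comul (s : H ⊗[k] H) (h : H) :
    cup k H (s * comul k H h) = counit k H h • cup k H s := by
  induction s using TensorProduct.induction_on with
  | zero => simp
  | tmul x y => simp [cup_tmul_mul, cup_comul]
  | add x y hx hy => simp only [add_mul, map_add, hx, hy, smul_add]

/-- `a ⊗ b ↦ S(b) ⊗ S(a)`. -/
def flipS : H ⊗[k] H →ₗ[k] H ⊗[k] H :=
  TensorProduct.map (S k H) (S k H) ∘ₗ (TensorProduct.comm k H H).toLinearMap

@[simp] theorem flipS_tmul (a b : H) : flipS k H (a ⊗ₜ b) = S k H b ⊗ₜ S k H a := rfl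

theorem flipS_mul (s t : H ⊗[k] H) : flipS k H (s * t) = flipS k H t * flipS k H s := by
  induction s using TensorProduct.induction_on with
  | zero => simp
  | add x y hx hy => simp only [add_mul, mul_add, map_add, hx, hy]
  | tmul a b =>
    induction t using TensorProduct.induction_on with
    | zero => simp
    | tmul x y => simp
    | add x y hx hy => simp only [add_mul, mul_add, map_add, hx, hy]

/-- `h ↦ S(h₂) ⊗ S(h₁)`. -/
abbrev copS : H →ₗ[k] H ⊗[k] H := antipodeCop k H

theorem copS_apply (h : H) : copS k H h = flipS k H (comul k H h) := rfl

theorem copS_mul (a b : H) : copS k H (a * b) = copS k H b * copS k H a := by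
  simp only [copS_apply, map_mul, flipS_mul]

/-- `s ⊗ c ↦ s (1 ⊗ β S(c))`. -/
def pMap : (H ⊗[k] H) ⊗[k] H →ₗ[k] H ⊗[k] H :=
  LinearMap.mul' k (H ⊗[k] H) ∘ₗ TensorProduct.map LinearMap.id
    (TensorProduct.mk k H H 1 ∘ₗ LinearMap.mulLeft k (β k H) ∘ₗ S k H)

@[simp] theorem pMap_tmul (s : H ⊗[k] H) (c : H) :
    pMap k H (s ⊗ₜ c) = s * (1 ⊗ₜ (β k H * S k H c)) := by simp [pMap]

/-- `p = x¹ ⊗ x² β S(x³)`. -/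
def pElt : H ⊗[k] H := pMap k H (PhiInv k H)

/-- `a ⊗ b ↦ Δ(a) s (1 ⊗ S(b))`. -/
def pAct (s : H ⊗[k] H) : H ⊗[k] H →ₗ[k] H ⊗[k] H :=
  LinearMap.mul' k (H ⊗[k] H) ∘ₗ TensorProduct.map (LinearMap.mulRight k s ∘ₗ comulL k H)
    (TensorProduct.mk k H H 1 ∘ₗ S k H)

@[simp] theorem pAct_tmul (s : H ⊗[k] H) (a b : H) :
    pAct k H s (a ⊗ₜ b) = comul k H a * s * (1 ⊗ₜ S k H b) := by simp [pAct]

theorem pAct_tmul_mul (s : H ⊗[k] H) (a b : H) (t : H ⊗[k] H) :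
    pAct k H s ((a ⊗ₜ b) * t) = comul k H a * pAct k H s t * (1 ⊗ₜ S k H b) := by
  induction t using TensorProduct.induction_on with
  | zero => simp
  | tmul x y =>
    have : (1 : H) ⊗ₜ[k] (S k H y * S k H b) = (1 ⊗ₜ[k] S k H y) * (1 ⊗ₜ[k] S k H b) := by simp
    simp only [Algebra.TensorProduct.tmul_mul_tmul, pAct_tmul, map_mul, S_mul, this, mul_assoc]
  | add x y hx hy => simp only [add_mul, mul_add, map_add, hx, hy]

theorem pMap_comulFst_mul (s : H ⊗[k] H) (t : (H ⊗[k] H) ⊗[k] H) :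
    pMap k H (comulFst k H s * t) = pAct k H (pMap k H t) s := by
  induction s using TensorProduct.induction_on with
  | zero => simp
  | add x y hx hy => simp only [add_mul, map_add, hx, hy]
  | tmul a b =>
    induction t using TensorProduct.induction_on with
    | zero => simp
    | tmul x y =>
      have : (1 : H) ⊗ₜ[k] (β k H * (S k H y * S k H b)) =
        (1 ⊗ₜ[k] (β k H * S k H y)) * (1 ⊗ₜ[k] S k H b) := by simp [mul_assoc]
      simp only [comulFst_tmul, Algebra.TensorProduct.tmul_mul_tmul, pMap_tmul, pAct_tmul,
        S_mul, this, mul_assoc]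
    | add x y hx hy =>
      simp only [pAct_tmul] at hx hy ⊢
      simp only [add_mul, mul_add, map_add, hx, hy]

theorem pMap_assoc_symm (a : H) (s : H ⊗[k] H) :
    pMap k H ((TensorProduct.assoc k H H H).symm (a ⊗ₜ s)) = a ⊗ₜ cup k H s := by
  induction s using TensorProduct.induction_on with
  | zero => simp
  | tmul x y => simp
  | add x y hx hy => simp only [map_add, TensorProduct.tmul_add, hx, hy]

theorem pMap_mul_comulSnd (t : (H ⊗[k] H) ⊗[k] H) (s : H ⊗[k] H) :
    pMap k H (t * comulSnd k H s) = pMap k H t *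
      (Algebra.TensorProduct.rid k k H
        (Algebra.TensorProduct.map (AlgHom.id k H) (counit k H) s) ⊗ₜ 1) := by
  induction s using TensorProduct.induction_on with
  | zero => simp
  | add x y hx hy => simp only [mul_add, map_add, hx, hy, TensorProduct.add_tmul]
  | tmul a b =>
    induction t using tensor_induction₃ with
    | zero => simp
    | tmul x y z =>
      rw [← TensorProduct.assoc_symm_tmul, comulSnd_tmul, assoc_symm_mul, pMap_assoc_symm,
        pMap_assoc_symm, cup_mul_comul]
      simp [TensorProduct.tmul_smul, TensorProduct.smul_tmul']
    | add x y hx hy => simp only [add_mul, map_add, hx, hy]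

/-- Quasi-coassociativity Φ⁻¹ (id ⊗ Δ)Δ(h) = (Δ ⊗ id)Δ(h) Φ⁻¹ seen through `pMap`, whose cup absorbs
the inner Δ on the left side. This is how p swallows coproducts later. -/
theorem pAct_pElt_comul (h : H) : pAct k H (pElt k H) (comul k H h) = pElt k H * (h ⊗ₜ 1) := by
  have := congrArg (pMap k H) (PhiInv_mul_comulSnd_comul k H h)
  rw [pMap_mul_comulSnd, pMap_comulFst_mul, counit_smul_comul_right] at this
  exact this.symm

/-- `s ⊗ c ↦ S(s₂) α c ⊗ S(s₁)`. -/
def qMap : (H ⊗[k] H) ⊗[k] H →ₗ[k] H ⊗[k] H :=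
  LinearMap.mul' k (H ⊗[k] H) ∘ₗ TensorProduct.map (flipS k H)
    ((TensorProduct.mk k H H).flip 1 ∘ₗ LinearMap.mulLeft k (α k H))

@[simp] theorem qMap_tmul (s : H ⊗[k] H) (c : H) :
    qMap k H (s ⊗ₜ c) = flipS k H s * ((α k H * c) ⊗ₜ 1) := by simp [qMap]

/-- `S(X²) α X³ ⊗ S(X¹)`. -/
def qElt : H ⊗[k] H := qMap k H (Phi k H)

/-- `a ⊗ b ↦ S(a₂) s¹ b ⊗ S(a₁) s²`. -/
def qAct (s : H ⊗[k] H) : H ⊗[k] H →ₗ[k] H ⊗[k] H :=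
  LinearMap.mul' k (H ⊗[k] H) ∘ₗ TensorProduct.map (LinearMap.mulRight k s ∘ₗ copS k H)
    ((TensorProduct.mk k H H).flip 1)

@[simp] theorem qAct_tmul (s : H ⊗[k] H) (a b : H) :
    qAct k H s (a ⊗ₜ b) = copS k H a * s * (b ⊗ₜ 1) := by simp [qAct]

theorem qMap_mul_comulFst (t : (H ⊗[k] H) ⊗[k] H) (s : H ⊗[k] H) :
    qMap k H (t * comulFst k H s) = qAct k H (qMap k H t) s := by
  induction s using TensorProduct.induction_on with
  | zero => simp
  | add x y hx hy => simp only [mul_add, map_add, hx, hy]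
  | tmul a b =>
    induction t using TensorProduct.induction_on with
    | zero => simp
    | tmul x y =>
      have : (α k H * (y * b)) ⊗ₜ[k] (1 : H) = ((α k H * y) ⊗ₜ[k] 1) * (b ⊗ₜ[k] 1) := by
        simp [mul_assoc]
      simp only [comulFst_tmul, Algebra.TensorProduct.tmul_mul_tmul, qMap_tmul, qAct_tmul,
        flipS_mul, copS_apply, this, mul_assoc]
    | add x y hx hy =>
      simp only [qAct_tmul] at hx hy ⊢
      simp only [add_mul, mul_add, map_add, hx, hy]

theorem qMap_assoc_symm (a : H) (s : H ⊗[k] H) :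
    qMap k H ((TensorProduct.assoc k H H H).symm (a ⊗ₜ s)) = cap k H s ⊗ₜ S k H a := by
  induction s using TensorProduct.induction_on with
  | zero => simp
  | tmul x y => simp
  | add x y hx hy => simp only [map_add, TensorProduct.tmul_add, TensorProduct.add_tmul, hx, hy]

theorem qMap_comulSnd_mul (s : H ⊗[k] H) (t : (H ⊗[k] H) ⊗[k] H) :
    qMap k H (comulSnd k H s * t) = qMap k H t *
      (1 ⊗ₜ S k H (Algebra.TensorProduct.rid k k H
        (Algebra.TensorProduct.map (AlgHom.id k H) (counit k H) s))) := by
  induction s using TensorProduct.induction_on with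
  | zero => simp
  | add x y hx hy => simp only [add_mul, mul_add, map_add, hx, hy, TensorProduct.tmul_add]
  | tmul a b =>
    induction t using tensor_induction₃ with
    | zero => simp
    | tmul x y z =>
      rw [← TensorProduct.assoc_symm_tmul, comulSnd_tmul, assoc_symm_mul, qMap_assoc_symm,
        qMap_assoc_symm, cap_comul_mul]
      simp [TensorProduct.tmul_smul, TensorProduct.smul_tmul']
    | add x y hx hy => simp only [add_mul, mul_add, map_add, hx, hy]

/-- Mirror image of `pAct_pElt_comul`: the cap in `qMap` absorbs the inner Δ of (id ⊗ Δ)Δ(h) Φ = Φ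
(Δ ⊗ id)Δ(h). -/
theorem qAct_qElt_comul (h : H) :
    qAct k H (qElt k H) (comul k H h) = qElt k H * (1 ⊗ₜ S k H h) := by
  have := congrArg (qMap k H) (comulSnd_comul_mul k H h)
  rw [qMap_mul_comulFst, qMap_comulSnd_mul, counit_smul_comul_right] at this
  exact this.symm

/-- `a ⊗ b ⊗ c ↦ Δ(a) s (1 ⊗ S(b) α c)`. -/
def pqMap (s : H ⊗[k] H) : (H ⊗[k] H) ⊗[k] H →ₗ[k] H ⊗[k] H :=
  LinearMap.mul' k (H ⊗[k] H) ∘ₗ TensorProduct.map (pAct k H s)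
    (TensorProduct.mk k H H 1 ∘ₗ LinearMap.mulLeft k (α k H))

@[simp] theorem pqMap_tmul (s u : H ⊗[k] H) (c : H) :
    pqMap k H s (u ⊗ₜ c) = pAct k H s u * (1 ⊗ₜ (α k H * c)) := by simp [pqMap]

/-- `a ⊗ b ⊗ c ⊗ d ↦ a ⊗ b β S(c) α d`. -/
def zigzagMap : ((H ⊗[k] H) ⊗[k] H) ⊗[k] H →ₗ[k] H ⊗[k] H :=
  LinearMap.mul' k (H ⊗[k] H) ∘ₗ TensorProduct.map (pMap k H)
    (TensorProduct.mk k H H 1 ∘ₗ LinearMap.mulLeft k (α k H))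

@[simp] theorem zigzagMap_tmul (t : (H ⊗[k] H) ⊗[k] H) (d : H) :
    zigzagMap k H (t ⊗ₜ d) = pMap k H t * (1 ⊗ₜ (α k H * d)) := by simp [zigzagMap]

theorem zigzagMap_assoc_symm (u v : H ⊗[k] H) :
    zigzagMap k H ((TensorProduct.assoc k (H ⊗[k] H) H H).symm (u ⊗ₜ v)) =
      u * (1 ⊗ₜ (β k H * cap k H v)) := by
  induction v using TensorProduct.induction_on with
  | zero => simp
  | tmul x y => simp [mul_assoc]
  | add x y hx hy => simp only [map_add, TensorProduct.tmul_add, mul_add, hx, hy]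

/-- In Δ₁(Φ)(Φ⁻¹ ⊗ 1) = Δ₃(Φ⁻¹)(1 ⊗ Φ)Δ₂(Φ), `zigzagMap` deletes the outer factors on the right.
Only 1 ⊗ Φ remains, evaluated by the axiom X¹ β S(X²) α X³ = 1. -/
theorem pqMap_pElt : pqMap k H (pElt k H) (Phi k H) = 1 := by
  have h := congrArg (zigzagMap k H) (comul₁_mul_PhiInv k H)
  rw [(map_comul₃_mul (zigzagMap k H) ?_ _).2, (map_mul_comul₂ (zigzagMap k H) ?_ _).1] at h
  rotate_left
  · intro h a v d
    simp [pMap_assoc_symm, cup_mul_comul]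
  · intro h u v
    simp [zigzagMap_assoc_symm, cap_comul_mul]
  have h₁ : ∀ y z, zigzagMap k H (comul₁ k H y * tmul_one k H z) =
      pqMap k H (pMap k H z) y := by
    intro y z
    induction y using tensor_induction₃ with
    | zero => simp
    | tmul a b c =>
      rw [pqMap_tmul, ← pMap_comulFst_mul, comul₁_tmul, tmul_one_apply,
        Algebra.TensorProduct.tmul_mul_tmul, zigzagMap_tmul, mul_one, comulFst_tmul]
    | add x y hx hy => simp only [map_add, add_mul, hx, hy]
  have h₂ : ∀ y, zigzagMap k H (one_tmul k H y) = 1 ⊗ₜ (LinearMap.mul' k H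
      (TensorProduct.map (cup k H) (LinearMap.mulLeft k (α k H)) y)) := by
    intro y
    induction y using tensor_induction₃ with
    | zero => simp
    | tmul a b c => simp [mul_assoc]
    | add x y hx hy => simp only [map_add, TensorProduct.tmul_add, hx, hy]
  rw [h₁, h₂] at h
  have h₃ := QuasiHopfAlgebra.assoc_antipode (k := k) (H := H)
  exact h.trans (congrArg _ h₃)

end Hopf
end QuasiHopf

namespace QuasiHopf

/-! ### The Drinfel'd twist: relations for δ, g, U and γ. -/

section Hopf

variable (k H : Type*) [Field k] [Ring H] [Algebra k H] [QuasiHopfAlgebra k H]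

/-- `a ⊗ b ⊗ c ↦ Δ(a) s (β S(c) ⊗ S(b))`. -/
def dMap (s : H ⊗[k] H) : (H ⊗[k] H) ⊗[k] H →ₗ[k] H ⊗[k] H :=
  LinearMap.mul' k (H ⊗[k] H) ∘ₗ TensorProduct.map (pAct k H s)
    ((TensorProduct.mk k H H).flip 1 ∘ₗ LinearMap.mulLeft k (β k H) ∘ₗ S k H)

@[simp] theorem dMap_tmul (s u : H ⊗[k] H) (c : H) :
    dMap k H s (u ⊗ₜ c) = pAct k H s u * ((β k H * S k H c) ⊗ₜ 1) := by simp [dMap]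

/-- Splitting S(X² x³) = S(x³) S(X²) isolates p: δ = Δ(X¹) p (β S(X³) ⊗ S(X²)). -/
theorem delta_eq : delta k H = dMap k H (pElt k H) (Phi k H) := by
  have key : ∀ y z, deltaMap k H (comul₁ k H y * tmul_one k H z) = dMap k H (pMap k H z) y := by
    intro y z
    induction y using tensor_induction₃ with
    | zero => simp
    | tmul a b c =>
      induction z using tensor_induction₃ with
      | zero => simp [pAct]
      | tmul x y z =>
        rw [comul₁_tmul, tmul_one_apply, dMap_tmul, pAct_tmul, pMap_tmul]
        generalize comul k H a = v
        induction v using TensorProduct.induction_on with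
        | zero => simp
        | tmul v w => simp [deltaMap_tmul, mul_assoc]
        | add x y hx hy => simp only [add_mul, map_add, TensorProduct.add_tmul, hx, hy]
      | add x y hx hy =>
        simp only [dMap_tmul, pAct_tmul] at hx hy ⊢
        simp only [map_add, mul_add, add_mul, hx, hy]
    | add x y hx hy => simp only [map_add, add_mul, hx, hy]
  exact key _ _

/-- `a ⊗ b ↦ Δ(a) s (S ⊗ S)(Δᶜᵒᵖ(b))`. -/
def eAct (s : H ⊗[k] H) : H ⊗[k] H →ₗ[k] H ⊗[k] H :=
  LinearMap.mul' k (H ⊗[k] H) ∘ₗ TensorProduct.map (LinearMap.mulRight k s ∘ₗ comulL k H)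
    (copS k H)

@[simp] theorem eAct_tmul (s : H ⊗[k] H) (a b : H) :
    eAct k H s (a ⊗ₜ b) = comul k H a * s * copS k H b := by simp [eAct]

theorem eAct_tmul_mul (s : H ⊗[k] H) (a b : H) (t : H ⊗[k] H) :
    eAct k H s ((a ⊗ₜ b) * t) = comul k H a * eAct k H s t * copS k H b := by
  induction t using TensorProduct.induction_on with
  | zero => simp
  | tmul x y =>
    simp only [Algebra.TensorProduct.tmul_mul_tmul, eAct_tmul, map_mul, copS_mul, mul_assoc]
  | add x y hx hy => simp only [add_mul, mul_add, map_add, hx, hy]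

theorem dMap_tmul_tmul (s : H ⊗[k] H) (a b c : H) :
    dMap k H s ((a ⊗ₜ b) ⊗ₜ c) = comul k H a * s * ((β k H * S k H c) ⊗ₜ S k H b) := by
  simp [mul_assoc]

theorem dMap_assoc_symm_mul (s : H ⊗[k] H) (a : H) (v : H ⊗[k] H) (t) :
    dMap k H s ((TensorProduct.assoc k H H H).symm (a ⊗ₜ v) * t) =
      comul k H a * dMap k H s t * flipS k H v := by
  induction v using TensorProduct.induction_on with
  | zero => simp
  | add x y hx hy => simp only [mul_add, add_mul, map_add, TensorProduct.tmul_add, hx, hy]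
  | tmul v w =>
    induction t using tensor_induction₃ with
    | zero => simp
    | tmul x y z =>
      rw [TensorProduct.assoc_symm_tmul, Algebra.TensorProduct.tmul_mul_tmul,
        Algebra.TensorProduct.tmul_mul_tmul, dMap_tmul_tmul, dMap_tmul_tmul]
      simp [mul_assoc]
    | add x y hx hy => simp only [mul_add, add_mul, map_add, hx, hy]

theorem dMap_comulSnd_mul (s u : H ⊗[k] H) (t) :
    dMap k H s (comulSnd k H u * t) = eAct k H (dMap k H s t) u := by
  induction u using TensorProduct.induction_on with
  | zero => simp
  | add x y hx hy => simp only [add_mul, map_add, hx, hy]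
  | tmul a b => rw [comulSnd_tmul, dMap_assoc_symm_mul, eAct_tmul, copS_apply]

theorem dMap_pElt_mul_comulFst (x y z : H) (u : H ⊗[k] H) :
    dMap k H (pElt k H) (((x ⊗ₜ y) ⊗ₜ z) * comulFst k H u) =
      comul k H x * pElt k H * ((cup k H u * S k H z) ⊗ₜ S k H y) := by
  induction u using TensorProduct.induction_on with
  | zero => simp
  | add x y hx hy =>
    simp only [mul_add, add_mul, map_add, TensorProduct.add_tmul, hx, hy]
  | tmul a b =>
    rw [comulFst_tmul, Algebra.TensorProduct.tmul_mul_tmul, dMap_tmul, pAct_tmul_mul,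
      pAct_pElt_comul]
    simp [mul_assoc]

/-- Quasi-coassociativity moves Δ to the other side of Φ in δ. There p turns Δ(h₁) into h₁ ⊗ 1, and
h₁ β S(h₂) collapses to ε(h) β. -/
theorem eAct_delta_comul (h : H) :
    eAct k H (delta k H) (comul k H h) = counit k H h • delta k H := by
  rw [delta_eq, ← dMap_comulSnd_mul, comulSnd_comul_mul]
  generalize Phi k H = t
  induction t using tensor_induction₃ with
  | zero => simp
  | tmul x y z =>
    rw [dMap_pElt_mul_comulFst, cup_comul, dMap_tmul_tmul]
    simp [← TensorProduct.smul_tmul']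
  | add x y hx hy => simp only [add_mul, map_add, smul_add, hx, hy]

theorem eAct_delta_mul_comul (s : H ⊗[k] H) (h : H) :
    eAct k H (delta k H) (s * comul k H h) = counit k H h • eAct k H (delta k H) s := by
  induction s using TensorProduct.induction_on with
  | zero => simp
  | tmul a b => simp [eAct_tmul_mul, eAct_delta_comul]
  | add x y hx hy => simp only [add_mul, map_add, smul_add, hx, hy]

theorem pAct_mul_comul (s : H ⊗[k] H) (h : H) :
    pAct k H (pElt k H) (s * comul k H h) = pAct k H (pElt k H) s * (h ⊗ₜ 1) := by
  induction s using TensorProduct.induction_on with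
  | zero => simp
  | tmul a b => simp [pAct_tmul_mul, pAct_pElt_comul, mul_assoc]
  | add x y hx hy => simp only [add_mul, map_add, hx, hy]

/-- `a ⊗ b ⊗ c ↦ Δ(a) s (S ⊗ S)(Δᶜᵒᵖ(b)) q (c ⊗ 1)`. -/
def eMap (s q : H ⊗[k] H) : (H ⊗[k] H) ⊗[k] H →ₗ[k] H ⊗[k] H :=
  LinearMap.mul' k (H ⊗[k] H) ∘ₗ TensorProduct.map (LinearMap.mulRight k q ∘ₗ eAct k H s)
    ((TensorProduct.mk k H H).flip 1)

@[simp] theorem eMap_tmul (s q u : H ⊗[k] H) (c : H) :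
    eMap k H s q (u ⊗ₜ c) = eAct k H s u * q * (c ⊗ₜ 1) := by simp [eMap]

/-- `a ⊗ b ⊗ c ⊗ d ↦ Δ(a) p (β S(c) α d ⊗ S(b))`. -/
def deltaZigzag : ((H ⊗[k] H) ⊗[k] H) ⊗[k] H →ₗ[k] H ⊗[k] H :=
  LinearMap.mul' k (H ⊗[k] H) ∘ₗ TensorProduct.map (dMap k H (pElt k H))
    ((TensorProduct.mk k H H).flip 1 ∘ₗ LinearMap.mulLeft k (α k H))

@[simp] theorem deltaZigzag_tmul (t : (H ⊗[k] H) ⊗[k] H) (d : H) :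
    deltaZigzag k H (t ⊗ₜ d) = dMap k H (pElt k H) t * ((α k H * d) ⊗ₜ 1) := by
  simp [deltaZigzag]

theorem deltaZigzag_assoc_symm (u v : H ⊗[k] H) :
    deltaZigzag k H ((TensorProduct.assoc k (H ⊗[k] H) H H).symm (u ⊗ₜ v)) =
      pAct k H (pElt k H) u * ((β k H * cap k H v) ⊗ₜ 1) := by
  induction v using TensorProduct.induction_on with
  | zero => simp
  | tmul x y => simp [mul_assoc]
  | add x y hx hy =>
    simp only [map_add, TensorProduct.tmul_add, TensorProduct.add_tmul, mul_add, hx, hy]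

/-- The pentagon under `deltaZigzag`. The cap on slots 3, 4 deletes Δ₃(Φ), and p absorbs the
coproduct of Δ₁(Φ), leaving p (X¹ β S(X²) α X³ ⊗ 1) = p. On the other side Φ ⊗ 1 assembles δ and 1 ⊗
Φ assembles Q. -/
theorem eMap_delta_qElt : eMap k H (delta k H) (qElt k H) (Phi k H) = pElt k H := by
  have h := congrArg (deltaZigzag k H) (pentagon k H)
  rw [(map_comul₃_mul (deltaZigzag k H) ?_ _).1] at h
  · have h₁ : ∀ y, deltaZigzag k H (comul₁ k H y) = pElt k H * (LinearMap.mul' k H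
        (TensorProduct.map (cup k H) (LinearMap.mulLeft k (α k H)) y) ⊗ₜ 1) := by
      intro y
      induction y using tensor_induction₃ with
      | zero => simp
      | tmul a b c =>
        rw [comul₁_tmul, deltaZigzag_tmul, dMap_tmul, pAct_pElt_comul]
        simp [mul_assoc]
      | add x y hx hy => simp only [map_add, TensorProduct.add_tmul, mul_add, hx, hy]
    have h₂ : ∀ x y z, deltaZigzag k H (one_tmul k H z * comul₂ k H y * tmul_one k H x) =
        eMap k H (dMap k H (pElt k H) x) (qMap k H z) y := by
      intro x y z
      induction y using tensor_induction₃ with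
      | zero => simp
      | tmul a b c =>
        induction z using tensor_induction₃ with
        | zero => simp
        | tmul z₁ z₂ z₃ =>
          rw [comul₂_tmul, one_tmul_tmul, tmul_one_apply, Algebra.TensorProduct.tmul_mul_tmul,
            Algebra.TensorProduct.tmul_mul_tmul, ← TensorProduct.assoc_symm_tmul, assoc_symm_mul,
            deltaZigzag_tmul, dMap_assoc_symm_mul, flipS_mul, eMap_tmul, eAct_tmul, copS_apply,
            qMap_tmul, one_mul, mul_one]
          simp only [mul_assoc, Algebra.TensorProduct.tmul_mul_tmul, mul_one]
        | add x y hx hy =>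
          simp only [map_add, add_mul, hx, hy]
          simp only [eMap_tmul, mul_add, add_mul]
      | add x y hx hy => simp only [map_add, mul_add, add_mul, hx, hy]
    rw [h₁, h₂, ← delta_eq] at h
    have h₃ := QuasiHopfAlgebra.assoc_antipode (k := k) (H := H)
    refine h.trans ?_
    refine (congrArg (fun t => pElt k H * (t ⊗ₜ[k] (1 : H))) h₃).trans ?_
    rw [← Algebra.TensorProduct.one_def, mul_one]
  · intro h u v
    rw [deltaZigzag_assoc_symm, deltaZigzag_assoc_symm, cap_comul_mul]
    simp [← TensorProduct.smul_tmul']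

/-- `s ⊗ c ↦ Δ(S(s¹) α s²) t (S ⊗ S)(Δᶜᵒᵖ(c))`. -/
def gMap (t : H ⊗[k] H) : (H ⊗[k] H) ⊗[k] H →ₗ[k] H ⊗[k] H :=
  LinearMap.mul' k (H ⊗[k] H) ∘ₗ
    TensorProduct.map (LinearMap.mulRight k t ∘ₗ comulL k H ∘ₗ cap k H) (copS k H)

@[simp] theorem gMap_tmul (t u : H ⊗[k] H) (c : H) :
    gMap k H t (u ⊗ₜ c) = comul k H (cap k H u) * t * copS k H c := by simp [gMap]

/-- `s ⊗ c ↦ Δ(S(s¹) α s²) t (1 ⊗ S(c))`. -/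
def uMap (t : H ⊗[k] H) : (H ⊗[k] H) ⊗[k] H →ₗ[k] H ⊗[k] H :=
  LinearMap.mul' k (H ⊗[k] H) ∘ₗ
    TensorProduct.map (LinearMap.mulRight k t ∘ₗ comulL k H ∘ₗ cap k H)
      (TensorProduct.mk k H H 1 ∘ₗ S k H)

@[simp] theorem uMap_tmul (t u : H ⊗[k] H) (c : H) :
    uMap k H t (u ⊗ₜ c) = comul k H (cap k H u) * t * (1 ⊗ₜ S k H c) := by simp [uMap]

theorem gMap_assoc_symm (t : H ⊗[k] H) (a : H) (v : H ⊗[k] H) :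
    gMap k H t ((TensorProduct.assoc k H H H).symm (a ⊗ₜ v)) =
      comul k H (S k H a * α k H) * eAct k H t v := by
  induction v using TensorProduct.induction_on with
  | zero => simp
  | tmul x y => simp only [TensorProduct.assoc_symm_tmul, gMap_tmul, cap_tmul, eAct_tmul, map_mul,
      mul_assoc]
  | add x y hx hy => simp only [map_add, TensorProduct.tmul_add, mul_add, hx, hy]

theorem uMap_assoc_symm (t : H ⊗[k] H) (a : H) (v : H ⊗[k] H) :
    uMap k H t ((TensorProduct.assoc k H H H).symm (a ⊗ₜ v)) =
      comul k H (S k H a * α k H) * pAct k H t v := by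
  induction v using TensorProduct.induction_on with
  | zero => simp
  | tmul x y => simp only [TensorProduct.assoc_symm_tmul, uMap_tmul, cap_tmul, pAct_tmul, map_mul,
      mul_assoc]
  | add x y hx hy => simp only [map_add, TensorProduct.tmul_add, mul_add, hx, hy]

/-- `t ⊗ d ↦ g(t) Q (d ⊗ 1)`. -/
def gZigzag : ((H ⊗[k] H) ⊗[k] H) ⊗[k] H →ₗ[k] H ⊗[k] H :=
  LinearMap.mul' k (H ⊗[k] H) ∘ₗ
    TensorProduct.map (LinearMap.mulRight k (qElt k H) ∘ₗ gMap k H (delta k H))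
      ((TensorProduct.mk k H H).flip 1)

@[simp] theorem gZigzag_tmul (t : (H ⊗[k] H) ⊗[k] H) (d : H) :
    gZigzag k H (t ⊗ₜ d) = gMap k H (delta k H) t * qElt k H * (d ⊗ₜ 1) := by
  simp [gZigzag]

/-- In Δ₃(Φ⁻¹)(1 ⊗ Φ) = Δ₁(Φ)(Φ⁻¹ ⊗ 1)Δ₂(Φ⁻¹), the cap deletes Δ₁ and δ deletes Δ₂, so the right
side evaluates to g Q. On the left, Q absorbs the coproduct of x³ and `eMap_delta_qElt` replaces δ
and Q by p. -/
theorem twistInv_mul_qElt : twistInv k H * qElt k H = uMap k H (pElt k H) (PhiInv k H) := by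
  have h := congrArg (gZigzag k H) (comul₃_inv_mul_one_tmul k H)
  rw [(map_comul₁_mul (gZigzag k H) ?_ _).1, (map_mul_comul₂ (gZigzag k H) ?_ _).2] at h
  · have key : ∀ y z, gZigzag k H (comul₃ k H z * one_tmul k H y) =
        uMap k H (eMap k H (delta k H) (qElt k H) y) z := by
      intro r z
      induction z using tensor_induction₃ with
      | zero => simp
      | tmul x y z =>
        induction r using tensor_induction₃ with
        | zero => simp
        | tmul a b c =>
          rw [comul₃_tmul, one_tmul_tmul, ← TensorProduct.assoc_symm_tmul (1 ⊗ₜ[k] a) b c, assoc_symm_mul₄,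
            uMap_tmul, eMap_tmul]
          have : ∀ v, gZigzag k H ((TensorProduct.assoc k (H ⊗[k] H) H H).symm
              ((x ⊗ₜ y * 1 ⊗ₜ a) ⊗ₜ (v * (b ⊗ₜ c)))) = comul k H (cap k H (x ⊗ₜ y)) *
                (comul k H a * delta k H * copS k H b * qAct k H (qElt k H) v * (c ⊗ₜ 1)) := by
            intro v
            induction v using TensorProduct.induction_on with
            | zero => simp
            | tmul v w =>
              simp only [Algebra.TensorProduct.tmul_mul_tmul, TensorProduct.assoc_symm_tmul,
                gZigzag_tmul, gMap_tmul, cap_tmul, map_mul, copS_mul, qAct_tmul, mul_assoc,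
                mul_one]
            | add x y hx hy =>
              simp only [map_add, add_mul, TensorProduct.tmul_add, mul_add, hx, hy]
          rw [this, qAct_qElt_comul]
          simp [mul_assoc]
        | add x y hx hy =>
          simp only [uMap_tmul] at hx hy ⊢
          simp only [map_add, mul_add, add_mul, hx, hy]
      | add x y hx hy => simp only [map_add, add_mul, hx, hy]
    rw [key, eMap_delta_qElt, tmul_one_apply, gZigzag_tmul, ← Algebra.TensorProduct.one_def,
      mul_one] at h
    exact h.symm
  · intro h a v d
    simp only [gZigzag_tmul, gMap_assoc_symm, eAct_delta_mul_comul]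
    simp
  · intro h u c d
    simp [cap_comul_mul]

theorem gMap_comulFst_mul (t : H ⊗[k] H) (s : H ⊗[k] H) (r) :
    gMap k H t (comulFst k H s * r) = gMap k H t r * copS k H (Algebra.TensorProduct.lid k H
      (Algebra.TensorProduct.map (counit k H) (AlgHom.id k H) s)) := by
  induction s using TensorProduct.induction_on with
  | zero => simp
  | add x y hx hy => simp only [add_mul, mul_add, map_add, hx, hy]
  | tmul a b =>
    induction r using TensorProduct.induction_on with
    | zero => simp
    | tmul u c => simp [cap_comul_mul, copS_mul, mul_assoc]
    | add x y hx hy => simp only [add_mul, mul_add, map_add, hx, hy]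

theorem uMap_comulFst_mul (t : H ⊗[k] H) (s : H ⊗[k] H) (r) :
    uMap k H t (comulFst k H s * r) = uMap k H t r * (1 ⊗ₜ S k H (Algebra.TensorProduct.lid k H
      (Algebra.TensorProduct.map (counit k H) (AlgHom.id k H) s))) := by
  induction s using TensorProduct.induction_on with
  | zero => simp
  | add x y hx hy => simp only [add_mul, mul_add, map_add, TensorProduct.tmul_add, hx, hy]
  | tmul a b =>
    induction r using TensorProduct.induction_on with
    | zero => simp
    | tmul u c => simp [cap_comul_mul, mul_assoc]
    | add x y hx hy => simp only [add_mul, mul_add, map_add, hx, hy]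

theorem gMap_mul_comulSnd (r) (s : H ⊗[k] H) :
    gMap k H (delta k H) (r * comulSnd k H s) = comul k H (S k H (Algebra.TensorProduct.rid k k H
      (Algebra.TensorProduct.map (AlgHom.id k H) (counit k H) s))) * gMap k H (delta k H) r := by
  induction s using TensorProduct.induction_on with
  | zero => simp
  | add x y hx hy => simp only [add_mul, mul_add, map_add, hx, hy]
  | tmul a b =>
    induction r using tensor_induction₃ with
    | zero => simp
    | tmul x y z =>
      rw [comulSnd_tmul, ← TensorProduct.assoc_symm_tmul, assoc_symm_mul, gMap_assoc_symm,
        gMap_assoc_symm, eAct_delta_mul_comul]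
      simp [mul_assoc]
    | add x y hx hy => simp only [add_mul, mul_add, map_add, hx, hy]

/-- Quasi-coassociativity for Φ⁻¹ under `gMap`: its cap absorbs Δ on the left, and δ absorbs Δ on
the right. Thus g conjugates (S ⊗ S)Δᶜᵒᵖ into Δ ∘ S. -/
theorem twistInv_mul_copS (h : H) :
    twistInv k H * copS k H h = comul k H (S k H h) * twistInv k H := by
  have := congrArg (gMap k H (delta k H)) (PhiInv_mul_comulSnd_comul k H h)
  rw [gMap_comulFst_mul, gMap_mul_comulSnd, counit_smul_comul_right, counit_smul_comul_left]
    at this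
  exact this.symm

/-- `a ⊗ b ↦ Δ(S(a)) s (b ⊗ 1)`. -/
def uAct (s : H ⊗[k] H) : H ⊗[k] H →ₗ[k] H ⊗[k] H :=
  LinearMap.mul' k (H ⊗[k] H) ∘ₗ TensorProduct.map (LinearMap.mulRight k s ∘ₗ comulL k H ∘ₗ S k H)
    ((TensorProduct.mk k H H).flip 1)

@[simp] theorem uAct_tmul (s : H ⊗[k] H) (a b : H) :
    uAct k H s (a ⊗ₜ b) = comul k H (S k H a) * s * (b ⊗ₜ 1) := by simp [uAct]

theorem uMap_mul_comulSnd (r) (s : H ⊗[k] H) :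
    uMap k H (pElt k H) (r * comulSnd k H s) = uAct k H (uMap k H (pElt k H) r) s := by
  induction s using TensorProduct.induction_on with
  | zero => simp
  | add x y hx hy => simp only [mul_add, map_add, hx, hy]
  | tmul a b =>
    induction r using tensor_induction₃ with
    | zero => simp
    | tmul x y z =>
      rw [comulSnd_tmul, ← TensorProduct.assoc_symm_tmul, assoc_symm_mul, uMap_assoc_symm,
        pAct_mul_comul, uAct_tmul, uMap_assoc_symm, S_mul]
      simp only [map_mul, mul_assoc]
    | add x y hx hy =>
      simp only [uAct_tmul] at hx hy ⊢
      simp only [add_mul, mul_add, map_add, hx, hy]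

/-- `Δ(S(x¹) α x²) p (1 ⊗ S(x³))`, the element `U`. -/
def uElt : H ⊗[k] H := uMap k H (pElt k H) (PhiInv k H)

/-- The same argument for U, with p in place of δ; p does not delete the coproduct but moves it out
as a factor on the right. -/
theorem uAct_uElt_comul (h : H) :
    uAct k H (uElt k H) (comul k H h) = uElt k H * (1 ⊗ₜ S k H h) := by
  have := congrArg (uMap k H (pElt k H)) (PhiInv_mul_comulSnd_comul k H h)
  rwa [uMap_comulFst_mul, uMap_mul_comulSnd, counit_smul_comul_left] at this

/-- `a ⊗ b ⊗ c ↦ (S ⊗ S)(Δᶜᵒᵖ(a)) q (b ⊗ α c)`. -/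
def gammaAct (q : H ⊗[k] H) : (H ⊗[k] H) ⊗[k] H →ₗ[k] H ⊗[k] H :=
  LinearMap.mul' k (H ⊗[k] H) ∘ₗ TensorProduct.map (qAct k H q)
    (TensorProduct.mk k H H 1 ∘ₗ LinearMap.mulLeft k (α k H))

@[simp] theorem gammaAct_tmul (q u : H ⊗[k] H) (c : H) :
    gammaAct k H q (u ⊗ₜ c) = qAct k H q u * (1 ⊗ₜ (α k H * c)) := by simp [gammaAct]

theorem gamma_eq : gamma k H = gammaAct k H (qElt k H) (PhiInv k H) := by
  have key : ∀ y z, gammaMap k H (tmul_one k H z * comul₁ k H y) =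
      gammaAct k H (qMap k H z) y := by
    intro y z
    induction y using tensor_induction₃ with
    | zero => simp
    | tmul a b c =>
      induction z using tensor_induction₃ with
      | zero => simp
      | tmul x y z =>
        rw [comul₁_tmul, tmul_one_apply, gammaAct_tmul, qAct_tmul, qMap_tmul, copS_apply]
        generalize comul k H a = v
        induction v using TensorProduct.induction_on with
        | zero => simp
        | tmul v w => simp [gammaMap_tmul, mul_assoc]
        | add x y hx hy => simp only [add_mul, mul_add, map_add, TensorProduct.add_tmul, hx, hy]
      | add x y hx hy =>
        simp only [gammaAct_tmul, qAct_tmul] at hx hy ⊢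
        simp only [map_add, mul_add, add_mul, hx, hy]
    | add x y hx hy => simp only [map_add, mul_add, hx, hy]
  exact key _ _

/-- `a ⊗ b ⊗ c ↦ Δ(S(a)) s (b ⊗ α c)`. -/
def vMap (s : H ⊗[k] H) : (H ⊗[k] H) ⊗[k] H →ₗ[k] H ⊗[k] H :=
  LinearMap.mul' k (H ⊗[k] H) ∘ₗ TensorProduct.map (uAct k H s)
    (TensorProduct.mk k H H 1 ∘ₗ LinearMap.mulLeft k (α k H))

@[simp] theorem vMap_tmul (s u : H ⊗[k] H) (c : H) :
    vMap k H s (u ⊗ₜ c) = uAct k H s u * (1 ⊗ₜ (α k H * c)) := by simp [vMap]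

/-- Moving g past (S ⊗ S)Δᶜᵒᵖ brings it next to Q, and g Q = U. -/
theorem twistInv_mul_gammaAct (y) :
    twistInv k H * gammaAct k H (qElt k H) y = vMap k H (uElt k H) y := by
  induction y using tensor_induction₃ with
  | zero => simp
  | tmul a b c =>
    rw [gammaAct_tmul, vMap_tmul, qAct_tmul, uAct_tmul, uElt, ← twistInv_mul_qElt]
    simp only [← mul_assoc]
    rw [twistInv_mul_copS]
  | add x y hx hy => simp only [map_add, mul_add, hx, hy]

/-- `a ⊗ b ⊗ c ⊗ d ↦ Δ(S(a) α b) p (1 ⊗ S(c) α d)`. -/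
def uZigzag : ((H ⊗[k] H) ⊗[k] H) ⊗[k] H →ₗ[k] H ⊗[k] H :=
  LinearMap.mul' k (H ⊗[k] H) ∘ₗ TensorProduct.map (uMap k H (pElt k H))
    (TensorProduct.mk k H H 1 ∘ₗ LinearMap.mulLeft k (α k H))

@[simp] theorem uZigzag_tmul (t : (H ⊗[k] H) ⊗[k] H) (d : H) :
    uZigzag k H (t ⊗ₜ d) = uMap k H (pElt k H) t * (1 ⊗ₜ (α k H * d)) := by simp [uZigzag]

theorem uZigzag_assoc_symm (u v : H ⊗[k] H) :
    uZigzag k H ((TensorProduct.assoc k (H ⊗[k] H) H H).symm (u ⊗ₜ v)) =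
      comul k H (cap k H u) * pElt k H * (1 ⊗ₜ cap k H v) := by
  induction v using TensorProduct.induction_on with
  | zero => simp
  | tmul x y => simp [mul_assoc]
  | add x y hx hy => simp only [map_add, TensorProduct.tmul_add, mul_add, hx, hy]

/-- In (Φ⁻¹ ⊗ 1)Δ₂(Φ⁻¹) = Δ₁(Φ⁻¹)Δ₃(Φ⁻¹)(1 ⊗ Φ) the two caps of `uZigzag` delete Δ₁ and Δ₃. What
remains is Δ(α) times the element that `pqMap_pElt` shows to be 1. -/
theorem vMap_uElt : vMap k H (uElt k H) (PhiInv k H) = comul k H (α k H) := by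
  have h := congrArg (uZigzag k H) (tmul_one_mul_comul₂ k H)
  rw [(map_comul₁_mul (uZigzag k H) ?_ _).2, (map_comul₃_mul (uZigzag k H) ?_ _).2] at h
  · have h₁ : ∀ y z, uZigzag k H (tmul_one k H z * comul₂ k H y) =
        vMap k H (uMap k H (pElt k H) z) y := by
      intro y z
      induction y using tensor_induction₃ with
      | zero => simp
      | tmul a b c =>
        rw [comul₂_tmul, tmul_one_apply, Algebra.TensorProduct.tmul_mul_tmul, uZigzag_tmul,
          ← comulSnd_tmul, uMap_mul_comulSnd, vMap_tmul, one_mul]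
      | add x y hx hy => simp only [map_add, mul_add, hx, hy]
    have h₂ : ∀ y, uZigzag k H (one_tmul k H y) =
        comul k H (α k H) * pqMap k H (pElt k H) y := by
      intro y
      induction y using tensor_induction₃ with
      | zero => simp
      | tmul a b c => simp [mul_assoc]
      | add x y hx hy => simp only [map_add, mul_add, hx, hy]
    rwa [h₁, h₂, pqMap_pElt, mul_one] at h
  · intro h u v
    simp [uZigzag_assoc_symm, cap_comul_mul]
  · intro h u c d
    simp [cap_comul_mul]

theorem twistInv_mul_gamma : twistInv k H * gamma k H = comul k H (α k H) := by
  rw [gamma_eq, twistInv_mul_gammaAct, vMap_uElt]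

/-- Moving g through (S ⊗ S)Δᶜᵒᵖ(x¹) and using g γ = Δ(α) turns gf into Δ(S(x¹) α x² β S(x³)) =
Δ(1). -/
theorem twistInv_mul_twist : twistInv k H * twist k H = 1 := by
  have key : ∀ z, twistInv k H * LinearMap.mul' k (H ⊗[k] H)
      (TensorProduct.map (LinearMap.mulRight k (gamma k H) ∘ₗ antipodeCop k H)
        (comulL k H ∘ₗ cup k H) (TensorProduct.assoc k H H H z)) =
      comul k H (LinearMap.mul' k H (TensorProduct.map (cap k H)
        (LinearMap.mulLeft k (β k H) ∘ₗ S k H) z)) := by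
    intro z
    induction z using tensor_induction₃ with
    | zero => simp
    | tmul a b c =>
      simp only [TensorProduct.assoc_tmul, TensorProduct.map_tmul, LinearMap.comp_apply,
        LinearMap.mul'_apply, LinearMap.mulRight_apply, LinearMap.mulLeft_apply, comulL_apply,
        cap_tmul, cup_tmul]
      rw [← mul_assoc, ← mul_assoc, twistInv_mul_copS, mul_assoc (comul k H _),
        twistInv_mul_gamma]
      simp only [map_mul, mul_assoc]
    | add x y hx hy => simp only [map_add, mul_add, hx, hy]
  refine (key _).trans ?_
  refine (congrArg (comul k H) (QuasiHopfAlgebra.assoc_inv_antipode (k := k) (H := H))).trans ?_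
  rw [map_one]

/-- One-sided inverses are two-sided in the finite-dimensional algebra H ⊗ H. -/
theorem twist_mul_twistInv [FiniteDimensional k H] : twist k H * twistInv k H = 1 :=
  haveI : IsArtinianRing (H ⊗[k] H) := IsArtinianRing.of_finite k _
  mul_eq_one_symm (twistInv_mul_twist k H)

end Hopf
end QuasiHopf

namespace QuasiHopf

/-! ### The coproduct identity for U. -/

section Hopf

variable (k H : Type*) [Field k] [Ring H] [Algebra k H] [QuasiHopfAlgebra k H]

/-- `s ↦ 1 ⊗ s`. -/
def one_tmul₂ : H ⊗[k] H →ₐ[k] (H ⊗[k] H) ⊗[k] H :=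
  Algebra.TensorProduct.map Algebra.TensorProduct.includeRight (AlgHom.id k H)

@[simp] theorem one_tmul₂_tmul (a b : H) : one_tmul₂ k H (a ⊗ₜ b) = (1 ⊗ₜ a) ⊗ₜ b := rfl

theorem assoc_symm_one_tmul (s : H ⊗[k] H) :
    (TensorProduct.assoc k H H H).symm (1 ⊗ₜ s) = one_tmul₂ k H s := by
  induction s using TensorProduct.induction_on with
  | zero => simp
  | tmul a b => simp
  | add x y hx hy => simp only [map_add, TensorProduct.tmul_add, hx, hy]

theorem tmul_one_mul_one_tmul₂ (a : H) (s : H ⊗[k] H) :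
    ((a ⊗ₜ 1) ⊗ₜ 1) * one_tmul₂ k H s = one_tmul₂ k H s * ((a ⊗ₜ 1) ⊗ₜ 1) := by
  induction s using TensorProduct.induction_on with
  | zero => simp
  | tmul a b => simp
  | add x y hx hy => simp only [map_add, mul_add, add_mul, hx, hy]

/-- `a ⊗ b ⊗ c ↦ a ⊗ Δ(b) s (1 ⊗ S(c))`. -/
def pActSnd (s : H ⊗[k] H) : (H ⊗[k] H) ⊗[k] H →ₗ[k] (H ⊗[k] H) ⊗[k] H :=
  LinearMap.mul' k ((H ⊗[k] H) ⊗[k] H) ∘ₗ TensorProduct.map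
    (LinearMap.mulRight k (one_tmul₂ k H s) ∘ₗ (comulSnd k H).toLinearMap)
    (TensorProduct.mk k (H ⊗[k] H) H 1 ∘ₗ S k H)

@[simp] theorem pActSnd_tmul (s u : H ⊗[k] H) (c : H) :
    pActSnd k H s (u ⊗ₜ c) = comulSnd k H u * one_tmul₂ k H s * (1 ⊗ₜ S k H c) := by
  simp [pActSnd]

/-- `t ⊗ d ↦ t (1 ⊗ 1 ⊗ β S(d))`. -/
def pMap₄ : ((H ⊗[k] H) ⊗[k] H) ⊗[k] H →ₗ[k] (H ⊗[k] H) ⊗[k] H :=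
  LinearMap.mul' k ((H ⊗[k] H) ⊗[k] H) ∘ₗ TensorProduct.map LinearMap.id
    (TensorProduct.mk k (H ⊗[k] H) H 1 ∘ₗ LinearMap.mulLeft k (β k H) ∘ₗ S k H)

@[simp] theorem pMap₄_tmul (t : (H ⊗[k] H) ⊗[k] H) (d : H) :
    pMap₄ k H (t ⊗ₜ d) = t * (1 ⊗ₜ (β k H * S k H d)) := by simp [pMap₄]

theorem pMap₄_assoc_symm (u v : H ⊗[k] H) :
    pMap₄ k H ((TensorProduct.assoc k (H ⊗[k] H) H H).symm (u ⊗ₜ v)) = u ⊗ₜ cup k H v := by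
  induction v using TensorProduct.induction_on with
  | zero => simp
  | tmul x y => simp
  | add x y hx hy => simp only [map_add, TensorProduct.tmul_add, hx, hy]

theorem pMap₄_tmul_one_mul (z) (t) :
    pMap₄ k H (tmul_one k H z * t) = z * pMap₄ k H t := by
  induction t using TensorProduct.induction_on with
  | zero => simp
  | tmul t d => simp [mul_assoc]
  | add x y hx hy => simp only [map_add, mul_add, hx, hy]

/-- The inverted pentagon with a cup on slots 3, 4, which deletes the rightmost factor Δ₃(Φ⁻¹). It
expresses (Δ ⊗ id)(p) by two copies of p. -/
theorem PhiInv_mul_pActSnd :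
    PhiInv k H * pActSnd k H (pElt k H) (PhiInv k H) = comulFst k H (pElt k H) := by
  have h := congrArg (pMap₄ k H) (pentagon_inv k H)
  rw [(map_mul_comul₃ (pMap₄ k H) ?_ _).2, pMap₄_tmul_one_mul] at h
  · have h₁ : ∀ y, pMap₄ k H (comul₁ k H y) = comulFst k H (pMap k H y) := by
      intro y
      induction y using tensor_induction₃ with
      | zero => simp
      | tmul a b c => simp
      | add x y hx hy => simp only [map_add, hx, hy]
    have h₂ : ∀ y z, pMap₄ k H (comul₂ k H y * one_tmul k H z) =
        pActSnd k H (pMap k H z) y := by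
      intro y z
      induction y using tensor_induction₃ with
      | zero => simp
      | tmul a b c =>
        induction z using tensor_induction₃ with
        | zero => simp
        | tmul z₁ z₂ z₃ =>
          have : (1 : H ⊗[k] H) ⊗ₜ[k] (β k H * (S k H z₃ * S k H c)) =
            (1 ⊗ₜ[k] (β k H * S k H z₃)) * (1 ⊗ₜ[k] S k H c) := by simp [mul_assoc]
          rw [comul₂_tmul, one_tmul_tmul, Algebra.TensorProduct.tmul_mul_tmul, pMap₄_tmul,
            pActSnd_tmul, pMap_tmul, comulSnd_tmul, S_mul, this, map_mul, one_tmul₂_tmul,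
            one_tmul₂_tmul, ← Algebra.TensorProduct.one_def]
          simp only [mul_assoc]
        | add x y hx hy =>
          simp only [pActSnd_tmul] at hx hy ⊢
          simp only [map_add, mul_add, add_mul, hx, hy]
      | add x y hx hy => simp only [map_add, add_mul, hx, hy]
    rwa [h₁, h₂] at h
  · intro h u v
    rw [pMap₄_assoc_symm, pMap₄_assoc_symm, cup_mul_comul, TensorProduct.tmul_smul]

/-- `a ⊗ b ⊗ c ↦ (Δ ⊗ id)(Δ(S(a)) s) (b ⊗ c ⊗ 1)`. -/
def rMap (s : H ⊗[k] H) : (H ⊗[k] H) ⊗[k] H →ₗ[k] (H ⊗[k] H) ⊗[k] H :=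
  LinearMap.mul' k ((H ⊗[k] H) ⊗[k] H) ∘ₗ TensorProduct.map
    ((comulFst k H).toLinearMap ∘ₗ LinearMap.mulRight k s ∘ₗ comulL k H ∘ₗ S k H)
    ((TensorProduct.mk k (H ⊗[k] H) H).flip 1) ∘ₗ (TensorProduct.assoc k H H H).toLinearMap

@[simp] theorem rMap_tmul (s : H ⊗[k] H) (a b c : H) :
    rMap k H s ((a ⊗ₜ b) ⊗ₜ c) =
      comulFst k H (comul k H (S k H a) * s) * ((b ⊗ₜ c) ⊗ₜ 1) := by
  simp [rMap]

/-- `t ⊗ d ↦ (id ⊗ Δ)(v(t)) (1 ⊗ p (1 ⊗ S(d)))`. -/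
def vMap₄ : ((H ⊗[k] H) ⊗[k] H) ⊗[k] H →ₗ[k] (H ⊗[k] H) ⊗[k] H :=
  LinearMap.mul' k ((H ⊗[k] H) ⊗[k] H) ∘ₗ TensorProduct.map
    (LinearMap.mulRight k (one_tmul₂ k H (pElt k H)) ∘ₗ (comulSnd k H).toLinearMap ∘ₗ
      vMap k H (uElt k H))
    (TensorProduct.mk k (H ⊗[k] H) H 1 ∘ₗ S k H)

@[simp] theorem vMap₄_tmul (t : (H ⊗[k] H) ⊗[k] H) (d : H) :
    vMap₄ k H (t ⊗ₜ d) = comulSnd k H (vMap k H (uElt k H) t) * one_tmul₂ k H (pElt k H) *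
      (1 ⊗ₜ S k H d) := by simp [vMap₄]

theorem vMap_mul_tmul (z) (a b c : H) : vMap k H (uElt k H) (z * ((a ⊗ₜ b) ⊗ₜ c)) =
    comul k H (S k H a) * vMap k H (uElt k H) z * (b ⊗ₜ c) := by
  induction z using tensor_induction₃ with
  | zero => simp
  | tmul x y z => simp [mul_assoc]
  | add x y hx hy => simp only [map_add, mul_add, add_mul, hx, hy]

theorem vMap_PhiInv_mul_tmul (a b c : H) :
    vMap k H (uElt k H) (PhiInv k H * ((a ⊗ₜ b) ⊗ₜ c)) =
    comul k H (S k H a * α k H) * (b ⊗ₜ c) := by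
  rw [vMap_mul_tmul, vMap_uElt, map_mul]

theorem vMap_PhiInv_mul (a : H) (v : H ⊗[k] H) :
    vMap k H (uElt k H) (PhiInv k H * (TensorProduct.assoc k H H H).symm (a ⊗ₜ v)) =
    comul k H (S k H a * α k H) * v := by
  induction v using TensorProduct.induction_on with
  | zero => simp
  | tmul b c => exact vMap_PhiInv_mul_tmul k H a b c
  | add x y hx hy => simp only [map_add, TensorProduct.tmul_add, mul_add, hx, hy]

theorem one_tmul_S_mul (x y : H) :
    (1 : H ⊗[k] H) ⊗ₜ[k] S k H (x * y) = (1 ⊗ₜ S k H y) * (1 ⊗ₜ S k H x) := by simp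

/-- U absorbs the coproduct in slots 1, 2 and leaves S(a) α b in its second leg; for y = Φ⁻¹ this
cap builds a second copy of U. -/
theorem vMap₄_comul₁ (y) :
    vMap₄ k H (comul₁ k H y) = comulSnd k H (uElt k H) * one_tmul₂ k H (uMap k H (pElt k H) y) := by
  induction y using tensor_induction₃ with
  | zero => simp
  | tmul a b c =>
    have : (1 : H) ⊗ₜ[k] S k H a * (1 : H) ⊗ₜ[k] (α k H * b) = 1 ⊗ₜ[k] cap k H (a ⊗ₜ b) := by
      simp
    rw [comul₁_tmul, vMap₄_tmul, vMap_tmul, uAct_uElt_comul, uMap_tmul, mul_assoc (uElt k H), this]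
    simp only [map_mul, comulSnd_tmul, assoc_symm_one_tmul, mul_assoc, one_tmul₂_tmul,
      ← Algebra.TensorProduct.one_def]
  | add x y hx hy => simp only [map_add, mul_add, hx, hy]

theorem vMap₄_path_aux (x₁ x₂ x₃ w₁ w₂ w₃ y₁ y₂ : H) (v : H ⊗[k] H) :
    vMap₄ k H (tmul_one k H (PhiInv k H) * (comul₂ k H ((x₁ ⊗ₜ x₂) ⊗ₜ x₃) *
      (one_tmul k H ((w₁ ⊗ₜ w₂) ⊗ₜ w₃) *
        (TensorProduct.assoc k (H ⊗[k] H) H H).symm ((y₁ ⊗ₜ y₂) ⊗ₜ v)))) =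
    comulSnd k H (comul k H (S k H y₁ * cap k H (x₁ ⊗ₜ x₂))) * (comulSnd k H (w₁ ⊗ₜ w₂) *
      (((y₂ ⊗ₜ 1) ⊗ₜ 1) * (one_tmul₂ k H (pAct k H (pElt k H) v) *
        ((1 ⊗ₜ S k H w₃) * (1 ⊗ₜ S k H x₃))))) := by
  induction v using TensorProduct.induction_on with
  | zero => simp
  | tmul v u =>
    have h₁ : comulSnd k H ((w₁ * y₂) ⊗ₜ (w₂ * v)) =
        comulSnd k H (w₁ ⊗ₜ w₂) * (((y₂ ⊗ₜ 1) ⊗ₜ 1) * one_tmul₂ k H (comul k H v)) := by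
      rw [← assoc_symm_one_tmul, ← comulSnd_tmul]
      have : (y₂ ⊗ₜ[k] (1 : H)) ⊗ₜ[k] (1 : H) = comulSnd k H (y₂ ⊗ₜ[k] (1 : H)) := by
        simp [Algebra.TensorProduct.one_def]
      rw [this, ← map_mul, ← map_mul]
      simp
    rw [TensorProduct.assoc_symm_tmul, one_tmul_tmul, Algebra.TensorProduct.tmul_mul_tmul,
      Algebra.TensorProduct.tmul_mul_tmul, Algebra.TensorProduct.tmul_mul_tmul, one_mul,
      comul₂_tmul, tmul_one_apply, Algebra.TensorProduct.tmul_mul_tmul,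
      Algebra.TensorProduct.tmul_mul_tmul, one_mul, ← TensorProduct.assoc_symm_tmul,
      assoc_symm_mul, vMap₄_tmul, vMap_PhiInv_mul, ← mul_assoc x₃, one_tmul_S_mul,
      one_tmul_S_mul, pAct_tmul]
    simp only [map_mul, h₁, mul_assoc, S_mul, cap_tmul, one_tmul₂_tmul,
      ← Algebra.TensorProduct.one_def]
  | add x y hx hy => simp only [map_add, TensorProduct.tmul_add, mul_add, add_mul, hx, hy]

/-- The factor Φ⁻¹ ⊗ 1 cancels U against its inverse associator, leaving Δ(α) by `vMap_uElt`; then p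
absorbs Δ(y₃). -/
theorem vMap₄_path (x₁ x₂ x₃ y₁ y₂ y₃ : H) (w : (H ⊗[k] H) ⊗[k] H) :
    vMap₄ k H (tmul_one k H (PhiInv k H) * (comul₂ k H ((x₁ ⊗ₜ x₂) ⊗ₜ x₃) *
      (one_tmul k H w * comul₃ k H ((y₁ ⊗ₜ y₂) ⊗ₜ y₃)))) =
    comulSnd k H (comul k H (S k H y₁ * cap k H (x₁ ⊗ₜ x₂))) * (pActSnd k H (pElt k H) w *
      ((y₂ ⊗ₜ y₃) ⊗ₜ S k H x₃)) := by
  induction w using tensor_induction₃ with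
  | zero => simp
  | tmul w₁ w₂ w₃ =>
    rw [comul₃_tmul, vMap₄_path_aux, pAct_pElt_comul, pActSnd_tmul,
      ← mul_assoc ((y₂ ⊗ₜ[k] (1 : H)) ⊗ₜ[k] (1 : H)), tmul_one_mul_one_tmul₂]
    simp [mul_assoc]
  | add x y hx hy => simp only [map_add, mul_add, add_mul, hx, hy]

/-- Moving the outer Φ⁻¹ to the right changes (id ⊗ Δ)Δ into (Δ ⊗ id)Δ and brings it to
`PhiInv_mul_pActSnd`, so every factor except the last becomes an image of Δ ⊗ id. -/
theorem PhiInv_mul_vMap₄ (x y : (H ⊗[k] H) ⊗[k] H) :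
    PhiInv k H * vMap₄ k H (tmul_one k H (PhiInv k H) *
      (comul₂ k H x * (one_tmul k H (PhiInv k H) * comul₃ k H y))) =
    rMap k H (uMap k H (pElt k H) x) y := by
  induction y using tensor_induction₃ with
  | zero => simp
  | tmul y₁ y₂ y₃ =>
    induction x using tensor_induction₃ with
    | zero => simp
    | tmul x₁ x₂ x₃ =>
      have : (1 : H ⊗[k] H) ⊗ₜ[k] S k H x₃ * ((y₂ ⊗ₜ y₃) ⊗ₜ 1) = (y₂ ⊗ₜ y₃) ⊗ₜ S k H x₃ := by simp
      rw [vMap₄_path, ← mul_assoc, PhiInv_mul_comulSnd_comul, mul_assoc, ← mul_assoc (PhiInv k H),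
        PhiInv_mul_pActSnd, rMap_tmul, uMap_tmul]
      simp only [map_mul, comulFst_tmul, map_one, mul_assoc, this]
    | add x y hx hy =>
      simp only [rMap_tmul] at hx hy ⊢
      simp only [map_add, mul_add, add_mul, hx, hy]
  | add x y hx hy => simp only [map_add, mul_add, hx, hy]

/-- `Φ⁻¹ (id ⊗ Δ)(U) (1 ⊗ U) = (Δ ⊗ id)(Δ(S(X¹)) U) (X² ⊗ X³ ⊗ 1)`. -/
theorem PhiInv_mul_comulSnd_uElt :
    PhiInv k H * (comulSnd k H (uElt k H) * one_tmul₂ k H (uElt k H)) =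
      rMap k H (uElt k H) (Phi k H) := by
  -- Evaluate Δ₁(Φ⁻¹) = (Φ⁻¹ ⊗ 1)Δ₂(Φ⁻¹)(1 ⊗ Φ⁻¹)Δ₃(Φ): the left side yields (id ⊗ Δ)(U)(1 ⊗ U),
  -- while on the right Δ₂(Φ⁻¹) rebuilds U and Δ₃(Φ) supplies X¹, X², X³.
  have h := congrArg (fun t => PhiInv k H * vMap₄ k H t) (comul₁_PhiInv k H)
  simp only [PhiInv_mul_vMap₄, vMap₄_comul₁] at h
  exact h

end Hopf

/-! ### Bijectivity of the antipode, and U without S⁻¹. -/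

section Antipode

variable {k H : Type*} [Field k] [Ring H] [Algebra k H] [QuasiHopfAlgebra k H]
  {R : Type*} [Ring R] [Algebra k R]

/-- `s ⊗ c ↦ u(s¹ β) T(s²) v(α c)`. -/
def linkMap (u v : H →ₐ[k] R) (T : H →ₗ[k] R) : (H ⊗[k] H) ⊗[k] H →ₗ[k] R :=
  LinearMap.mul' k R ∘ₗ TensorProduct.map
    (LinearMap.mul' k R ∘ₗ TensorProduct.map (u.toLinearMap ∘ₗ LinearMap.mulRight k (β k H)) T)
    (v.toLinearMap ∘ₗ LinearMap.mulLeft k (α k H))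

@[simp] theorem linkMap_tmul (u v : H →ₐ[k] R) (T : H →ₗ[k] R) (a b c : H) :
    linkMap u v T ((a ⊗ₜ b) ⊗ₜ c) = u (a * β k H) * T b * v (α k H * c) := by
  simp [linkMap]

theorem linkMap_tmul_left (u v : H →ₐ[k] R) (w : H ⊗[k] H) (c : H) :
    linkMap u v (u.toLinearMap ∘ₗ S k H) (w ⊗ₜ c) = u (cup k H w) * v (α k H * c) := by
  induction w using TensorProduct.induction_on with
  | zero => simp
  | tmul a b => simp [mul_assoc]
  | add x y hx hy => simp only [map_add, TensorProduct.add_tmul, add_mul, hx, hy]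

theorem linkMap_assoc_symm {u v : H →ₐ[k] R} (huv : ∀ h, u (S k H h) = v (S k H h)) (a : H)
    (w : H ⊗[k] H) :
    linkMap u v (u.toLinearMap ∘ₗ S k H) ((TensorProduct.assoc k H H H).symm (a ⊗ₜ w)) =
      u (a * β k H) * v (cap k H w) := by
  induction w using TensorProduct.induction_on with
  | zero => simp
  | tmul a b => simp [huv, mul_assoc]
  | add x y hx hy => simp only [map_add, TensorProduct.tmul_add, mul_add, hx, hy]

theorem linkMap_mul_comulFst (u v : H →ₐ[k] R) (t) (s : H ⊗[k] H) :
    linkMap u v (u.toLinearMap ∘ₗ S k H) (t * comulFst k H s) =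
      linkMap u v (u.toLinearMap ∘ₗ S k H) t * v (Algebra.TensorProduct.lid k H
        (Algebra.TensorProduct.map (counit k H) (AlgHom.id k H) s)) := by
  induction s using TensorProduct.induction_on with
  | zero => simp
  | add x y hx hy => simp only [map_add, mul_add, hx, hy]
  | tmul a b =>
    induction t using TensorProduct.induction_on with
    | zero => simp
    | tmul w c =>
      rw [comulFst_tmul, Algebra.TensorProduct.tmul_mul_tmul, linkMap_tmul_left,
        linkMap_tmul_left, cup_mul_comul]
      simp [mul_assoc]
    | add x y hx hy => simp only [map_add, add_mul, hx, hy]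

theorem linkMap_comulSnd_mul {u v : H →ₐ[k] R} (huv : ∀ h, u (S k H h) = v (S k H h))
    (s : H ⊗[k] H) (t) :
    linkMap u v (u.toLinearMap ∘ₗ S k H) (comulSnd k H s * t) =
      u (Algebra.TensorProduct.rid k k H
        (Algebra.TensorProduct.map (AlgHom.id k H) (counit k H) s)) *
      linkMap u v (u.toLinearMap ∘ₗ S k H) t := by
  induction s using TensorProduct.induction_on with
  | zero => simp
  | add x y hx hy => simp only [map_add, add_mul, hx, hy]
  | tmul a b =>
    induction t using tensor_induction₃ with
    | zero => simp
    | tmul x y z =>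
      rw [comulSnd_tmul, ← TensorProduct.assoc_symm_tmul, assoc_symm_mul, linkMap_assoc_symm huv,
        linkMap_assoc_symm huv, cap_comul_mul]
      simp [mul_assoc]
    | add x y hx hy => simp only [map_add, mul_add, hx, hy]

/-- Since u ∘ S = v ∘ S, the middle factor of c = u(X¹ β S(X²)) v(α X³) can join either neighbour.
The cup under u and the cap under v absorb the coproducts in quasi-coassociativity, so c intertwines
u and v. -/
theorem mul_linkMap_Phi {u v : H →ₐ[k] R} (huv : ∀ h, u (S k H h) = v (S k H h)) (h : H) :
    u h * linkMap u v (u.toLinearMap ∘ₗ S k H) (Phi k H) =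
      linkMap u v (u.toLinearMap ∘ₗ S k H) (Phi k H) * v h := by
  have := congrArg (linkMap u v (u.toLinearMap ∘ₗ S k H)) (comulSnd_comul_mul k H h)
  rwa [linkMap_comulSnd_mul huv, linkMap_mul_comulFst, counit_smul_comul_right,
    counit_smul_comul_left] at this

variable (k H) in
/-- `a ⊗ b ⊗ c ↦ S(a) α b β S(c)`. -/
def capCup : (H ⊗[k] H) ⊗[k] H →ₗ[k] H :=
  LinearMap.mul' k H ∘ₗ TensorProduct.map (cap k H) (LinearMap.mulLeft k (β k H) ∘ₗ S k H)

@[simp] theorem capCup_tmul (w : H ⊗[k] H) (c : H) :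
    capCup k H (w ⊗ₜ c) = cap k H w * (β k H * S k H c) := by simp [capCup]

variable (k H) in
theorem capCup_PhiInv : capCup k H (PhiInv k H) = 1 := QuasiHopfAlgebra.assoc_inv_antipode

theorem capCup_assoc_symm (a : H) (w : H ⊗[k] H) :
    capCup k H ((TensorProduct.assoc k H H H).symm (a ⊗ₜ w)) =
      S k H a * (α k H * cup k H w) := by
  induction w using TensorProduct.induction_on with
  | zero => simp
  | tmul a b => simp [mul_assoc]
  | add x y hx hy => simp only [map_add, TensorProduct.tmul_add, mul_add, hx, hy]

/-- `t ⊗ d ↦ u(t) v(α d)`, where `u` is applied to `S(t¹) α t² β S(t³)`. -/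
def linkMap₄ (u v : H →ₐ[k] R) : ((H ⊗[k] H) ⊗[k] H) ⊗[k] H →ₗ[k] R :=
  LinearMap.mul' k R ∘ₗ TensorProduct.map (u.toLinearMap ∘ₗ capCup k H)
    (v.toLinearMap ∘ₗ LinearMap.mulLeft k (α k H))

@[simp] theorem linkMap₄_tmul (u v : H →ₐ[k] R) (t : (H ⊗[k] H) ⊗[k] H) (d : H) :
    linkMap₄ u v (t ⊗ₜ d) = u (capCup k H t) * v (α k H * d) := by simp [linkMap₄]

theorem linkMap₄_assoc_symm {u v : H →ₐ[k] R} (huv : ∀ h, u (S k H h) = v (S k H h))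
    (w w' : H ⊗[k] H) :
    linkMap₄ u v ((TensorProduct.assoc k (H ⊗[k] H) H H).symm (w ⊗ₜ w')) =
      u (cap k H w * β k H) * v (cap k H w') := by
  induction w' using TensorProduct.induction_on with
  | zero => simp
  | tmul a b => simp [huv, mul_assoc]
  | add x y hx hy => simp only [map_add, TensorProduct.tmul_add, mul_add, hx, hy]

/-- Under `linkMap₄` all three coproduct factors of the pentagon are deleted. Of the two that
remain, Φ⁻¹ ⊗ 1 gives v(α) by the axiom S(x¹) α x² β S(x³) = 1, and 1 ⊗ Φ gives u(α) c. -/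
theorem alpha_mul_linkMap_Phi {u v : H →ₐ[k] R} (huv : ∀ h, u (S k H h) = v (S k H h)) :
    u (α k H) * linkMap u v (u.toLinearMap ∘ₗ S k H) (Phi k H) = v (α k H) := by
  have h := congrArg (linkMap₄ u v) (comul₁_mul_PhiInv k H)
  rw [(map_comul₁_mul (linkMap₄ u v) ?_ _).1, (map_comul₃_mul (linkMap₄ u v) ?_ _).2,
    (map_mul_comul₂ (linkMap₄ u v) ?_ _).1] at h
  · have key : ∀ y, linkMap₄ u v (one_tmul k H y) =
        u (α k H) * linkMap u v (u.toLinearMap ∘ₗ S k H) y := by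
      intro y
      induction y using tensor_induction₃ with
      | zero => simp
      | tmul a b c => simp [mul_assoc]
      | add x y hx hy => simp only [map_add, mul_add, hx, hy]
    rw [key, tmul_one_apply, linkMap₄_tmul, capCup_PhiInv, map_one, one_mul, mul_one] at h
    exact h.symm
  · intro h a w d
    simp [capCup_assoc_symm, cup_mul_comul]
  · intro h w w'
    simp [linkMap₄_assoc_symm huv, cap_comul_mul]
  · intro h w c d
    simp [cap_comul_mul]

/-- By the two previous lemmas c v(α) = u(α) c = v(α), and c commutes with v(S(x)) = u(S(x)). So c
fixes v(S(x¹) α x² β S(x³)) = 1 under left multiplication. -/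
theorem linkMap_Phi {u v : H →ₐ[k] R} (huv : ∀ h, u (S k H h) = v (S k H h)) :
    linkMap u v (u.toLinearMap ∘ₗ S k H) (Phi k H) = 1 := by
  set c := linkMap u v (u.toLinearMap ∘ₗ S k H) (Phi k H) with hc
  have hα : c * v (α k H) = v (α k H) := by
    rw [← mul_linkMap_Phi huv, alpha_mul_linkMap_Phi huv]
  have key : ∀ y, c * v (capCup k H y) = v (capCup k H y) := by
    intro y
    induction y using tensor_induction₃ with
    | zero => simp
    | tmul x y z =>
      simp only [capCup_tmul, cap_tmul, map_mul, mul_assoc]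
      rw [← mul_assoc c, ← mul_linkMap_Phi huv, ← hc, huv, mul_assoc, ← mul_assoc c, hα]
    | add x y hx hy => simp only [map_add, mul_add, hx, hy]
  simpa [capCup_PhiInv] using key (PhiInv k H)

/-- The antipode of a quasi-Hopf algebra is an epimorphism of algebras. -/
theorem algHom_eq_of_comp_S {u v : H →ₐ[k] R} (huv : ∀ h, u (S k H h) = v (S k H h)) : u = v := by
  ext h
  simpa [linkMap_Phi huv] using mul_linkMap_Phi huv h

variable (k H) in
/-- The square of the antipode. -/
def sqS : H →ₐ[k] H :=
  AlgHom.ofLinearMap (S k H ∘ₗ S k H) (by simp) (by simp)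

@[simp] theorem sqS_apply (h : H) : sqS k H h = S k H (S k H h) := rfl

/-- The maps u ∘ S and v ∘ S are algebra maps into the opposite of R, so one antipode can be
cancelled there and the other in R. -/
theorem algHom_eq_of_comp_sqS {u v : H →ₐ[k] R} (huv : ∀ h, u (sqS k H h) = v (sqS k H h)) :
    u = v := by
  have key : ∀ w : H →ₐ[k] R, ∃ w' : H →ₐ[k] Rᵐᵒᵖ, ∀ h, w' h = MulOpposite.op (w (S k H h)) :=
    fun w => ⟨AlgHom.ofLinearMap
      ((MulOpposite.opLinearEquiv k).toLinearMap ∘ₗ w.toLinearMap ∘ₗ S k H) (by simp) (by simp),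
      fun _ => rfl⟩
  obtain ⟨u', hu⟩ := key u
  obtain ⟨v', hv⟩ := key v
  have h : u' = v' := algHom_eq_of_comp_S fun h => by
    rw [hu, hv]; exact congrArg _ (huv h)
  exact algHom_eq_of_comp_S fun x => MulOpposite.op_injective <| by rw [← hu, ← hv, h]

theorem algHom_eq_of_comp_sqS_pow {u v : H →ₐ[k] R} (n : ℕ)
    (huv : ∀ h, u ((sqS k H ^ n) h) = v ((sqS k H ^ n) h)) : u = v := by
  induction n with
  | zero => ext h; exact huv h
  | succ n ih =>
    refine ih fun h => ?_
    have : u.comp (sqS k H ^ n) = v.comp (sqS k H ^ n) := algHom_eq_of_comp_sqS fun x => by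
      simpa [pow_succ] using huv x
    exact DFunLike.congr_fun this h

variable (k H) in
-- By Fitting, H is the direct sum of the kernel and range of f = S²ⁿ for large n. The projection
-- onto the range is an algebra map agreeing with the identity on that range, so it is the identity
-- and f is onto.
theorem S_bijective [FiniteDimensional k H] : Function.Bijective (S k H) := by
  obtain ⟨n, hn, hc⟩ := ((Filter.eventually_ge_atTop 1).and
    (LinearMap.eventually_isCompl_ker_pow_range_pow (sqS k H).toLinearMap)).exists
  set f : H →ₐ[k] H := sqS k H ^ n with hf
  have hpow : ∀ x, ((sqS k H).toLinearMap ^ n) x = f x := by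
    intro x
    rw [hf]
    clear hn hc hf
    induction n generalizing x with
    | zero => simp
    | succ n ih => simp [pow_succ, ih]
  -- The kernel and range span H: only the range component of x contributes to f(x).
  have hex : ∀ x, ∃ y, f (f y) = f x := by
    intro x
    obtain ⟨a, ha, b, ⟨y, hy⟩, hab⟩ := Submodule.mem_sup.1
      (hc.sup_eq_top ▸ Submodule.mem_top : x ∈ _)
    refine ⟨y, ?_⟩
    rw [LinearMap.mem_ker, hpow] at ha
    rw [hpow] at hy
    rw [← hab, map_add, ha, zero_add, hy]
  -- The kernel meets the range trivially, so f is injective on its range.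
  have huniq : ∀ x y, f (f x) = f (f y) → f x = f y := by
    intro x y hxy
    have h₀ : f (x - y) = 0 := by
      refine (Submodule.disjoint_def.1 hc.disjoint) _ ?_ ⟨x - y, hpow _⟩
      rw [LinearMap.mem_ker, hpow, map_sub, map_sub, hxy, sub_self]
    rwa [map_sub, sub_eq_zero] at h₀
  choose g hg using hex
  -- The Fitting projection x ↦ f(g(x)). The choice g need not be linear or multiplicative, but
  -- f(g(x)) is unique by `huniq`, which makes e an algebra map.
  let e : H →ₐ[k] H := AlgHom.ofLinearMap
    { toFun := fun x => f (g x)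
      map_add' := fun x y => by
        rw [← map_add]; apply huniq; simp only [map_add, hg]
      map_smul' := fun c x => by
        rw [RingHom.id_apply, ← map_smul]; apply huniq; simp only [map_smul, hg] }
    (by
      change f (g 1) = 1
      rw [← map_one f]; apply huniq; simp only [map_one, hg])
    (fun x y => by
      change f (g (x * y)) = f (g x) * f (g y)
      rw [← map_mul]; apply huniq; simp only [map_mul, hg])
  have he : e = AlgHom.id k H := algHom_eq_of_comp_sqS_pow n fun h => huniq _ _ (hg _)
  have hsurj : Function.Surjective (S k H) := by
    intro x
    have hx : f (g x) = x := DFunLike.congr_fun he x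
    -- Here n ≥ 1 matters: f must contain at least one factor S for its surjectivity to pass to S.
    obtain ⟨m, rfl⟩ : ∃ m, n = m + 1 := ⟨n - 1, by omega⟩
    refine ⟨S k H ((sqS k H ^ m) (g x)), ?_⟩
    rw [← sqS_apply]
    rw [hf, pow_succ'] at hx
    exact hx
  exact ⟨LinearMap.injective_iff_surjective.2 hsurj, hsurj⟩

theorem S_antipodeInv (hS : Function.Bijective (S k H)) (h : H) :
    S k H (antipodeInv k H h) = h := by
  rw [antipodeInv, dif_pos hS]
  exact (LinearEquiv.ofBijective (S k H) hS).apply_symm_apply h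

/-- Applying S to S⁻¹(α X³) X² gives S(X²) α X³, so the flipped q_R becomes Q, and g Q is already
known. -/
theorem U_eq (hS : Function.Bijective (S k H)) : U k H = uElt k H := by
  have key : ∀ y, TensorProduct.map (S k H) (S k H) (TensorProduct.comm k H H
      (TensorProduct.map LinearMap.id
        (LinearMap.mul' k H ∘ₗ
          TensorProduct.map (antipodeInv k H ∘ₗ LinearMap.mulLeft k (α k H)) LinearMap.id ∘ₗ
          (TensorProduct.comm k H H).toLinearMap)
        (TensorProduct.assoc k H H H y))) = qMap k H y := by
    intro y
    induction y using tensor_induction₃ with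
    | zero => simp
    | tmul a b c => simp [S_antipodeInv hS]
    | add x y hx hy => simp only [map_add, hx, hy]
  exact (congrArg (twistInv k H * ·) (key _)).trans (twistInv_mul_qElt k H)

end Antipode
end QuasiHopf

namespace HeisenbergDouble
open QuasiHopf

/-! ### Products with elements ε # a in the Heisenberg double. -/

section Product

variable {k H : Type*} [Field k] [Ring H] [Algebra k H]

variable (k H) in
/-- The identification of `H* ⊗ H` with the Heisenberg double. -/
def ofTensor : Module.Dual k H ⊗[k] H →ₗ[k] HeisenbergDouble k H where
  toFun t := t
  map_add' _ _ := rfl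
  map_smul' _ _ := rfl

@[simp] theorem ofTensor_tmul (ξ : Module.Dual k H) (a : H) : ofTensor k H (ξ ⊗ₜ a) = mk ξ a := rfl

theorem induction_on {p : HeisenbergDouble k H → Prop} (zero : p 0) (mk : ∀ ξ a, p (mk ξ a))
    (add : ∀ x y, p x → p y → p (x + y)) (d : HeisenbergDouble k H) : p d :=
  TensorProduct.induction_on (motive := p) d zero mk add

@[simp] theorem mkLin_apply (ξ : Module.Dual k H) (a : H) : mkLin ξ a = mk ξ a := rfl

@[simp] theorem smul_mk (c : k) (ξ : Module.Dual k H) (a : H) : mk (c • ξ) a = c • mk ξ a := rfl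

variable [QuasiBialgebra k H]

theorem hit_eps (x : H) : hit k H (eps k H) x = counit k H x • eps k H := by
  ext y
  simp [hit_apply, eps, mul_comm]

theorem conv_eps_left (ξ : Module.Dual k H) : conv k H (eps k H ⊗ₜ ξ) = ξ := by
  ext y
  conv_rhs => rw [← counit_smul_comul_left k H y]
  simp only [conv, LinearMap.comp_apply, LinearMap.dualMap_apply, comulL_apply]
  generalize comul k H y = s
  induction s using TensorProduct.induction_on with
  | zero => simp
  | tmul a b => simp [eps]
  | add x y hx hy => simp only [map_add, hx, hy]

theorem conv_eps_right (ξ : Module.Dual k H) : conv k H (ξ ⊗ₜ eps k H) = ξ := by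
  ext y
  conv_rhs => rw [← counit_smul_comul_right k H y]
  simp only [conv, LinearMap.comp_apply, LinearMap.dualMap_apply, comulL_apply]
  generalize comul k H y = s
  induction s using TensorProduct.induction_on with
  | zero => simp
  | tmul a b => simp [eps, mul_comm]
  | add x y hx hy => simp only [map_add, hx, hy]

/-- `s ↦ (s¹ ⇀ ν) # s² b`. -/
def hitMk (ν : Module.Dual k H) (b : H) : H ⊗[k] H →ₗ[k] HeisenbergDouble k H :=
  ofTensor k H ∘ₗ TensorProduct.map (hit k H ν) (LinearMap.mulRight k b)

@[simp] theorem hitMk_tmul (ν : Module.Dual k H) (b x y : H) :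
    hitMk ν b (x ⊗ₜ y) = mk (hit k H ν x) (y * b) := rfl

/-- `t ↦ (t¹ ⇀ ξ) ∗ (t² ⇀ ν) # t³ b`. -/
def convMk (ξ ν : Module.Dual k H) (b : H) : (H ⊗[k] H) ⊗[k] H →ₗ[k] HeisenbergDouble k H :=
  ofTensor k H ∘ₗ TensorProduct.map
    (conv k H ∘ₗ TensorProduct.map (hit k H ξ) (hit k H ν)) (LinearMap.mulRight k b)

@[simp] theorem convMk_tmul (ξ ν : Module.Dual k H) (b : H) (x y z : H) :
    convMk ξ ν b ((x ⊗ₜ y) ⊗ₜ z) = mk (conv k H (hit k H ξ x ⊗ₜ hit k H ν y)) (z * b) := rfl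

theorem mk_mul_mk' (ξ : Module.Dual k H) (a : H) (ν : Module.Dual k H) (b : H) :
    mk ξ a * mk ν b = convMk ξ ν b (PhiInv k H *
      (TensorProduct.assoc k H H H).symm (1 ⊗ₜ comul k H a)) := mk_mul_mk ξ a ν b

theorem convMk_eps_left (ν : Module.Dual k H) (b : H) (t) :
    convMk (eps k H) ν b t = hitMk ν b (counit₁ k H t) := by
  induction t using tensor_induction₃ with
  | zero => simp
  | tmul x y z => simp [hit_eps, ← TensorProduct.smul_tmul', conv_eps_left]
  | add x y hx hy => simp only [map_add, hx, hy]

theorem convMk_eps_right (ξ : Module.Dual k H) (b : H) (t) :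
    convMk ξ (eps k H) b t = hitMk ξ b (counit₂ k H t) := by
  induction t using tensor_induction₃ with
  | zero => simp
  | tmul x y z => simp [hit_eps, TensorProduct.tmul_smul, ← TensorProduct.smul_tmul', conv_eps_right]
  | add x y hx hy => simp only [map_add, hx, hy]

theorem counit₁_assoc_symm (s : H ⊗[k] H) :
    counit₁ k H ((TensorProduct.assoc k H H H).symm (1 ⊗ₜ s)) = s := by
  induction s using TensorProduct.induction_on with
  | zero => simp
  | tmul a b => simp
  | add x y hx hy => simp only [map_add, TensorProduct.tmul_add, hx, hy]

theorem counit₂_assoc_symm (s : H ⊗[k] H) :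
    counit₂ k H ((TensorProduct.assoc k H H H).symm (1 ⊗ₜ s)) = 1 ⊗ₜ Algebra.TensorProduct.lid k H
      (Algebra.TensorProduct.map (counit k H) (AlgHom.id k H) s) := by
  induction s using TensorProduct.induction_on with
  | zero => simp
  | tmul a b => simp [TensorProduct.smul_tmul]
  | add x y hx hy => simp only [map_add, TensorProduct.tmul_add, hx, hy]

/-- The left factor ε puts ε in the first slot of Φ⁻¹, so the associator drops out. -/
theorem epsMk_mul_mk (a : H) (ν : Module.Dual k H) (b : H) :
    epsMk k a * mk ν b = hitMk ν b (comul k H a) := by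
  rw [epsMk_apply, mk_mul_mk', convMk_eps_left, map_mul, counit₁_PhiInv, one_mul,
    counit₁_assoc_symm]

theorem mk_mul_epsMk (ξ : Module.Dual k H) (a b : H) :
    mk ξ a * epsMk k b = mk ξ (a * b) := by
  have : hit k H ξ 1 = ξ := by ext; simp [hit_apply]
  rw [epsMk_apply, mk_mul_mk', convMk_eps_right, map_mul, counit₂_PhiInv, one_mul,
    counit₂_assoc_symm, counit_smul_comul_left, hitMk_tmul, this]

theorem epsMk_mul_epsMk (a b : H) : epsMk k a * epsMk k b = epsMk k (a * b) :=
  mk_mul_epsMk _ a b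

theorem epsMk_one_mul (d : HeisenbergDouble k H) : epsMk k (1 : H) * d = d := by
  induction d using induction_on with
  | zero => simp
  | mk ξ a =>
    have : hit k H ξ 1 = ξ := by ext; simp [hit_apply]
    rw [epsMk_mul_mk, map_one, Algebra.TensorProduct.one_def, hitMk_tmul, this, one_mul]
  | add x y hx hy => rw [mul_add, hx, hy]

theorem mul_epsMk_one (d : HeisenbergDouble k H) : d * epsMk k (1 : H) = d := by
  induction d using induction_on with
  | zero => simp
  | mk ξ a => rw [mk_mul_epsMk, mul_one]
  | add x y hx hy => rw [add_mul, hx, hy]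

theorem hitMk_mul_epsMk (ν : Module.Dual k H) (b c : H) (s : H ⊗[k] H) :
    hitMk ν b s * epsMk k c = hitMk ν (b * c) s := by
  induction s using TensorProduct.induction_on with
  | zero => simp
  | tmul x y => simp [mk_mul_epsMk, mul_assoc]
  | add x y hx hy => simp only [map_add, add_mul, hx, hy]

/-- The left factor acts through Δ(a) from the left and the right factor only multiplies the H-part
on the right, so they do not interact. -/
theorem epsMk_mul_mul_epsMk (a b : H) (d : HeisenbergDouble k H) :
    epsMk k a * d * epsMk k b = epsMk k a * (d * epsMk k b) := by
  induction d using induction_on with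
  | zero => simp
  | mk ξ c => rw [mk_mul_epsMk, epsMk_mul_mk, epsMk_mul_mk, hitMk_mul_epsMk]
  | add x y hx hy => simp only [add_mul, mul_add, hx, hy]

end Product

/-! ### Bracketing, dual-basis sums, and the quasi-pentagon equation. -/

section Legs

variable {k H : Type*} [Field k] [Ring H] [Algebra k H] [QuasiBialgebra k H]

variable (k H) in
/-- `a ⊗ d ↦ (ε # a) ⊗ d`. -/
def epsFst : H ⊗[k] HeisenbergDouble k H →ₗ[k] HeisenbergDouble k H ⊗[k] HeisenbergDouble k H :=
  TensorProduct.map (epsMk k) LinearMap.id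

@[simp] theorem epsFst_tmul (a : H) (d : HeisenbergDouble k H) :
    epsFst k H (a ⊗ₜ d) = epsMk k a ⊗ₜ d := rfl

variable (k H) in
/-- `a ⊗ b ⊗ c ↦ (ε # a) ⊗ (ε # b) ⊗ (ε # c)`. -/
def eps₃ : (H ⊗[k] H) ⊗[k] H →ₗ[k]
    (HeisenbergDouble k H ⊗[k] HeisenbergDouble k H) ⊗[k] HeisenbergDouble k H :=
  TensorProduct.map (TensorProduct.map (epsMk k) (epsMk k)) (epsMk k)

@[simp] theorem eps₃_tmul (a b c : H) :
    eps₃ k H ((a ⊗ₜ b) ⊗ₜ c) = (epsMk k a ⊗ₜ epsMk k b) ⊗ₜ epsMk k c := rfl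

@[simp] theorem leg12_tmul (x y : HeisenbergDouble k H) :
    leg12 (x ⊗ₜ[k] y) = (x ⊗ₜ y) ⊗ₜ epsMk k (1 : H) := rfl
@[simp] theorem leg23_tmul (x y : HeisenbergDouble k H) :
    leg23 (x ⊗ₜ[k] y) = (epsMk k (1 : H) ⊗ₜ x) ⊗ₜ y := rfl
@[simp] theorem leg13_tmul (x y : HeisenbergDouble k H) :
    leg13 (x ⊗ₜ[k] y) = (x ⊗ₜ epsMk k (1 : H)) ⊗ₜ y := rfl

variable (x y : HeisenbergDouble k H ⊗[k] HeisenbergDouble k H)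

theorem leg12_add : leg12 (x + y) = leg12 x + leg12 y := TensorProduct.add_tmul _ _ _
theorem leg13_add : leg13 (x + y) = leg13 x + leg13 y := map_add _ _ _
theorem leg23_add : leg23 (x + y) = leg23 x + leg23 y := by
  simp only [leg23, TensorProduct.tmul_add, map_add]
@[simp] theorem leg12_zero : leg12 (0 : HeisenbergDouble k H ⊗[k] HeisenbergDouble k H) = 0 :=
  TensorProduct.zero_tmul _ _
@[simp] theorem leg13_zero : leg13 (0 : HeisenbergDouble k H ⊗[k] HeisenbergDouble k H) = 0 :=
  map_zero _
@[simp] theorem leg23_zero : leg23 (0 : HeisenbergDouble k H ⊗[k] HeisenbergDouble k H) = 0 := by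
  simp [leg23]

theorem leg12_leg13_leg23_assoc (u v w : H ⊗[k] HeisenbergDouble k H) :
    leg12 (epsFst k H u) * leg13 (epsFst k H v) * leg23 (epsFst k H w) =
      leg12 (epsFst k H u) * (leg13 (epsFst k H v) * leg23 (epsFst k H w)) := by
  induction u using TensorProduct.induction_on with
  | zero => simp
  | add x y hx hy => simp only [map_add, leg12_add, add_mul, hx, hy]
  | tmul a d =>
    induction v using TensorProduct.induction_on with
    | zero => simp
    | add x y hx hy => simp only [map_add, leg13_add, add_mul, mul_add, hx, hy]
    | tmul a' d' =>
      induction w using TensorProduct.induction_on with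
      | zero => simp
      | add x y hx hy => simp only [map_add, leg23_add, mul_add, hx, hy]
      | tmul a'' d'' =>
        simp only [epsFst_tmul, leg12_tmul, leg13_tmul, leg23_tmul,
          Algebra.TensorProduct.tmul_mul_tmul, mul_epsMk_one, epsMk_one_mul]

/-- The middle leg contains no unit; its product (ε # a) d (ε # b) is covered by
`epsMk_mul_mul_epsMk`. -/
theorem leg23_leg12_eps₃_assoc (u v : H ⊗[k] HeisenbergDouble k H) (t) :
    leg23 (epsFst k H u) * leg12 (epsFst k H v) * eps₃ k H t =
      leg23 (epsFst k H u) * (leg12 (epsFst k H v) * eps₃ k H t) := by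
  induction u using TensorProduct.induction_on with
  | zero => simp
  | add x y hx hy => simp only [map_add, leg23_add, add_mul, hx, hy]
  | tmul a d =>
    induction v using TensorProduct.induction_on with
    | zero => simp
    | add x y hx hy => simp only [map_add, leg12_add, add_mul, mul_add, hx, hy]
    | tmul a' d' =>
      induction t using tensor_induction₃ with
      | zero => simp
      | add x y hx hy => simp only [map_add, mul_add, hx, hy]
      | tmul b₁ b₂ b₃ =>
        simp only [epsFst_tmul, leg12_tmul, leg23_tmul, eps₃_tmul,
          Algebra.TensorProduct.tmul_mul_tmul, mul_epsMk_one, epsMk_one_mul, epsMk_mul_mul_epsMk]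

theorem leg23_leg13_leg12_assoc (u v w : H ⊗[k] HeisenbergDouble k H) :
    leg23 (epsFst k H u) * leg13 (epsFst k H v) * leg12 (epsFst k H w) =
      leg23 (epsFst k H u) * (leg13 (epsFst k H v) * leg12 (epsFst k H w)) := by
  induction u using TensorProduct.induction_on with
  | zero => simp
  | add x y hx hy => simp only [map_add, leg23_add, add_mul, hx, hy]
  | tmul a d =>
    induction v using TensorProduct.induction_on with
    | zero => simp
    | add x y hx hy => simp only [map_add, leg13_add, add_mul, mul_add, hx, hy]
    | tmul a' d' =>
      induction w using TensorProduct.induction_on with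
      | zero => simp
      | add x y hx hy => simp only [map_add, leg12_add, mul_add, hx, hy]
      | tmul a'' d'' =>
        simp only [epsFst_tmul, leg12_tmul, leg13_tmul, leg23_tmul,
          Algebra.TensorProduct.tmul_mul_tmul, mul_epsMk_one, epsMk_one_mul]

theorem eps₃_leg12_leg23_assoc (t) (u v : H ⊗[k] HeisenbergDouble k H) :
    eps₃ k H t * leg12 (epsFst k H u) * leg23 (epsFst k H v) =
      eps₃ k H t * (leg12 (epsFst k H u) * leg23 (epsFst k H v)) := by
  induction u using TensorProduct.induction_on with
  | zero => simp
  | add x y hx hy => simp only [map_add, leg12_add, add_mul, mul_add, hx, hy]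
  | tmul a d =>
    induction v using TensorProduct.induction_on with
    | zero => simp
    | add x y hx hy => simp only [map_add, leg23_add, mul_add, hx, hy]
    | tmul a' d' =>
      induction t using tensor_induction₃ with
      | zero => simp
      | add x y hx hy => simp only [map_add, add_mul, hx, hy]
      | tmul b₁ b₂ b₃ =>
        simp only [epsFst_tmul, leg12_tmul, leg23_tmul, eps₃_tmul,
          Algebra.TensorProduct.tmul_mul_tmul, mul_epsMk_one, epsMk_one_mul, epsMk_mul_mul_epsMk]

variable {I : Type*} [Fintype I] (e : Module.Basis I k H)

theorem hit_coord (e : Module.Basis I k H) (i : I) (a : H) :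
    hit k H (e.coord i) a = ∑ m, e.coord i (e m * a) • e.coord m := by
  refine e.ext fun j => ?_
  classical
  simp [hit_apply, Finsupp.single_apply]

/-- `∑ᵢ G(eᵢ p¹) ⊗ (s¹ ⇀ eⁱ # s² p²) = ∑ᵢ G(eᵢ s¹ p¹) ⊗ (eⁱ # s² p²)`. -/
theorem sum_tmul_hitMk {X : Type*} [AddCommGroup X] [Module k X] (G : H →ₗ[k] X) (p₁ p₂ : H)
    (s : H ⊗[k] H) : ∑ i, G (e i * p₁) ⊗ₜ[k] hitMk (e.coord i) p₂ s =
      ∑ i, TensorProduct.map G (mkLin (e.coord i)) ((e i ⊗ₜ 1) * (s * (p₁ ⊗ₜ p₂))) := by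
  induction s using TensorProduct.induction_on with
  | zero => simp
  | add x y hx hy =>
    simp only [map_add, TensorProduct.tmul_add, add_mul, mul_add, Finset.sum_add_distrib, hx, hy]
  | tmul a b =>
    have h₁ : ∀ i, hitMk (e.coord i) p₂ (a ⊗ₜ b) =
        ∑ m, e.coord i (e m * a) • mk (e.coord m) (b * p₂) := by
      intro i
      rw [hitMk_tmul, hit_coord e]
      simp only [← smul_mk]
      exact map_sum ((ofTensor k H) ∘ₗ (TensorProduct.mk k _ _).flip (b * p₂)) _ _
    simp only [h₁, TensorProduct.tmul_sum, TensorProduct.tmul_smul]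
    rw [Finset.sum_comm]
    refine Finset.sum_congr rfl fun m _ => ?_
    simp only [TensorProduct.smul_tmul', ← TensorProduct.sum_tmul, ← map_smul, ← map_sum,
      ← smul_mul_assoc, ← Finset.sum_mul]
    rw [show ∑ i, e.coord i (e m * a) • e i = e m * a from e.sum_repr _]
    simp [mul_assoc]

/-- Convolution is dual to Δ: summing eₗ ⊗ eⱼ against eˡ ∗ eʲ gives Δ(eₘ) against eᵐ. The actions of
the first two slots of t become right multiplications of Δ(eₘ). -/
theorem sum_tmul_convMk {X : Type*} [AddCommGroup X] [Module k X] (G : H ⊗[k] H →ₗ[k] X)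
    (p : H ⊗[k] H) (b : H) (t : (H ⊗[k] H) ⊗[k] H) :
    ∑ l, ∑ j, G ((e l ⊗ₜ e j) * p) ⊗ₜ[k] convMk (e.coord l) (e.coord j) b t =
      ∑ m, TensorProduct.map G (mkLin (e.coord m)) (comulFst k H (e m ⊗ₜ 1) * (t * (p ⊗ₜ b))) := by
  induction t using tensor_induction₃ with
  | zero => simp
  | add x y hx hy =>
    simp only [map_add, TensorProduct.tmul_add, add_mul, mul_add, Finset.sum_add_distrib, hx, hy]
  | tmul x y z =>
    have h₁ : ∀ l j, conv k H (hit k H (e.coord l) x ⊗ₜ hit k H (e.coord j) y) =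
        ∑ m, (TensorProduct.dualDistrib k H H (e.coord l ⊗ₜ e.coord j)
          (comul k H (e m) * (x ⊗ₜ y))) • e.coord m := by
      intro l j
      refine e.ext fun n => ?_
      classical
      have h₂ : ∀ s : H ⊗[k] H, TensorProduct.dualDistrib k H H
          (hit k H (e.coord l) x ⊗ₜ hit k H (e.coord j) y) s =
          TensorProduct.dualDistrib k H H (e.coord l ⊗ₜ e.coord j) (s * (x ⊗ₜ y)) := by
        intro s
        induction s using TensorProduct.induction_on with
        | zero => simp
        | tmul a b => simp [hit_apply]
        | add x y hx hy => simp only [map_add, add_mul, hx, hy]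
      simp [conv, h₂, Finsupp.single_apply]
    have h₃ : ∀ l j, convMk (e.coord l) (e.coord j) b ((x ⊗ₜ y) ⊗ₜ z) =
        ∑ m, (TensorProduct.dualDistrib k H H (e.coord l ⊗ₜ e.coord j)
          (comul k H (e m) * (x ⊗ₜ y))) • mk (e.coord m) (z * b) := by
      intro l j
      rw [convMk_tmul, h₁]
      simp only [← smul_mk]
      exact map_sum ((ofTensor k H) ∘ₗ (TensorProduct.mk k _ _).flip (z * b)) _ _
    -- Expansion of s in the basis eₗ ⊗ eⱼ of H ⊗ H, to be used with s = Δ(eₘ)(x ⊗ y).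
    have h₄ : ∀ s : H ⊗[k] H, ∑ l, ∑ j,
        (TensorProduct.dualDistrib k H H (e.coord l ⊗ₜ e.coord j) s) • (e l ⊗ₜ[k] e j) = s := by
      intro s
      induction s using TensorProduct.induction_on with
      | zero => simp
      | tmul a b =>
        conv_rhs => rw [← e.sum_repr a, ← e.sum_repr b]
        simp only [TensorProduct.sum_tmul, TensorProduct.tmul_sum, TensorProduct.dualDistrib_apply,
          TensorProduct.tmul_smul, ← TensorProduct.smul_tmul', smul_smul, Finset.smul_sum,
          Module.Basis.coord_apply]
        rw [Finset.sum_comm]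
        simp only [mul_comm]
      | add x y hx hy => simp only [map_add, add_smul, Finset.sum_add_distrib, hx, hy]
    simp only [h₃, TensorProduct.tmul_sum, TensorProduct.tmul_smul]
    have h₅ : ∀ l : I, ∑ j, ∑ m, (TensorProduct.dualDistrib k H H (e.coord l ⊗ₜ e.coord j)
        (comul k H (e m) * (x ⊗ₜ y))) • (G (e l ⊗ₜ e j * p) ⊗ₜ[k] mk (e.coord m) (z * b)) =
        ∑ m, ∑ j, (TensorProduct.dualDistrib k H H (e.coord l ⊗ₜ e.coord j)
        (comul k H (e m) * (x ⊗ₜ y))) • (G (e l ⊗ₜ e j * p) ⊗ₜ[k] mk (e.coord m) (z * b)) :=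
      fun l => Finset.sum_comm
    simp only [h₅]
    rw [Finset.sum_comm]
    refine Finset.sum_congr rfl fun m _ => ?_
    simp only [TensorProduct.smul_tmul', ← TensorProduct.sum_tmul, ← map_smul, ← map_sum,
      ← smul_mul_assoc, ← Finset.sum_mul]
    simp only [TensorProduct.smul_tmul'] at h₄
    rw [h₄]
    simp [mul_assoc]

theorem sum_mul_sum_mul_sum {A ι₁ ι₂ ι₃ : Type*} [NonUnitalNonAssocRing A] [Fintype ι₁] [Fintype ι₂]
    [Fintype ι₃] (f : ι₁ → A) (g : ι₂ → A) (h : ι₃ → A) :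
    (∑ i, f i) * (∑ j, g j) * (∑ l, h l) = ∑ i, ∑ j, ∑ l, f i * g j * h l := by
  rw [Finset.sum_mul_sum, Finset.sum_mul]
  exact Finset.sum_congr rfl fun i _ => Finset.sum_mul_sum _ _ _ _

theorem sum_comm₃ {A ι₁ ι₂ ι₃ : Type*} [AddCommMonoid A] [Fintype ι₁] [Fintype ι₂] [Fintype ι₃]
    (f : ι₁ → ι₂ → ι₃ → A) : ∑ l, ∑ j, ∑ i, f l j i = ∑ i, ∑ l, ∑ j, f l j i := by
  rw [Finset.sum_comm (s := Finset.univ) (f := fun i l => ∑ j, f l j i)]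
  exact Finset.sum_congr rfl fun l _ => Finset.sum_comm

theorem W_eq : W e = epsFst k H (∑ i, e i ⊗ₜ mk (e.coord i) 1) := by
  simp [W]

theorem leg12_W : leg12 (W e) = ∑ i, (epsMk k (e i) ⊗ₜ mk (e.coord i) 1) ⊗ₜ epsMk k (1 : H) :=
  TensorProduct.sum_tmul _ _ _

theorem leg13_W : leg13 (W e) = ∑ i, (epsMk k (e i) ⊗ₜ epsMk k (1 : H)) ⊗ₜ mk (e.coord i) 1 :=
  map_sum _ _ _

theorem leg23_W : leg23 (W e) = ∑ i, (epsMk k (1 : H) ⊗ₜ epsMk k (e i)) ⊗ₜ mk (e.coord i) 1 := by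
  simp [leg23, W, TensorProduct.tmul_sum]

/-- `a ⊗ b ↦ (ε # y a) ⊗ (ξ # b)`. -/
def pairMk (y : H) (ξ : Module.Dual k H) :
    H ⊗[k] H →ₗ[k] HeisenbergDouble k H ⊗[k] HeisenbergDouble k H :=
  TensorProduct.map (epsMk k ∘ₗ LinearMap.mulLeft k y) (mkLin ξ)

/-- Φ⁻¹ enters from the third leg, the product (eˡ # 1)(eʲ # 1), and Δ(eₘ) from the convolution in
it. -/
theorem leg12_leg13_leg23_W : leg12 (W e) * leg13 (W e) * leg23 (W e) =
    ∑ i, ∑ m, TensorProduct.map (pairMk (e i) (e.coord i)) (mkLin (e.coord m))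
      (comulFst k H (e m ⊗ₜ 1) * PhiInv k H) := by
  rw [leg12_W, leg13_W, leg23_W, sum_mul_sum_mul_sum]
  simp only [Algebra.TensorProduct.tmul_mul_tmul, epsMk_mul_epsMk,
    mul_epsMk_one, epsMk_one_mul, mk_mul_epsMk, one_mul]
  refine Finset.sum_congr rfl fun i _ => ?_
  have h := sum_tmul_convMk e (pairMk (e i) (e.coord i)) 1 1 (PhiInv k H)
  have h₁ : ∀ l j : I, convMk (e.coord l) (e.coord j) 1 (PhiInv k H) =
      mk (e.coord l) 1 * mk (e.coord j) 1 := by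
    intro l j
    rw [mk_mul_mk', map_one, Algebra.TensorProduct.one_def]
    exact congrArg _ (mul_one _).symm
  simp only [h₁, mul_one, ← Algebra.TensorProduct.one_def] at h
  exact h

/-- Here Δ(eₘ) comes from (ε # eₘ)(eⁱ # 1) in the middle leg, its first half being moved onto eᵢ,
while Φ⁻¹ is present from the start. -/
theorem leg23_leg12_W_PhiInvBold : leg23 (W e) * leg12 (W e) * PhiInvBold k H =
    ∑ i, ∑ m, TensorProduct.map (pairMk (e i) (e.coord i)) (mkLin (e.coord m))
      (comulFst k H (e m ⊗ₜ 1) * PhiInv k H) := by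
  have key : ∀ t, leg23 (W e) * leg12 (W e) * eps₃ k H t =
    ∑ i, ∑ m, TensorProduct.map (pairMk (e i) (e.coord i)) (mkLin (e.coord m))
      (comulFst k H (e m ⊗ₜ 1) * t) := by
    intro t
    induction t using tensor_induction₃ with
    | zero => simp
    | add x y hx hy => simp only [map_add, mul_add, hx, hy, Finset.sum_add_distrib]
    | tmul x y z =>
      have h : ∀ m, ∑ i, epsMk k (e i * x) ⊗ₜ[k] hitMk (e.coord i) y (comul k H (e m)) =
          ∑ i, pairMk (e i) (e.coord i) (comul k H (e m) * (x ⊗ₜ y)) := by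
        intro m
        rw [sum_tmul_hitMk]
        refine Finset.sum_congr rfl fun i _ => ?_
        generalize comul k H (e m) * (x ⊗ₜ[k] y) = s
        induction s using TensorProduct.induction_on with
        | zero => simp
        | tmul a b => simp [pairMk]
        | add x y hx hy => simp only [map_add, mul_add, hx, hy]
      rw [leg12_W, leg23_W, Finset.sum_mul_sum, Finset.sum_mul]
      conv_rhs => rw [Finset.sum_comm]
      refine Finset.sum_congr rfl fun m _ => ?_
      rw [Finset.sum_mul]
      simp only [Algebra.TensorProduct.tmul_mul_tmul, eps₃_tmul, epsMk_mul_epsMk, mul_epsMk_one,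
        mk_mul_epsMk, one_mul, epsMk_mul_mk, hitMk_mul_epsMk, comulFst_tmul,
        TensorProduct.map_tmul, mkLin_apply, ← TensorProduct.sum_tmul, h]
  exact key _

end Legs

/-! ### The quasi-Hopf equation for W̃. -/

section Hopf

variable {k H : Type*} [Field k] [Ring H] [Algebra k H] [QuasiHopfAlgebra k H]
  {I : Type*} [Fintype I] (e : Module.Basis I k H)

/-- `a ⊗ b ↦ ∑ᵢ S(eᵢ a) ⊗ (eⁱ # b)`. -/
def wtildeMap : H ⊗[k] H →ₗ[k] H ⊗[k] HeisenbergDouble k H :=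
  ∑ i, TensorProduct.map (S k H ∘ₗ LinearMap.mulLeft k (e i)) (mkLin (e.coord i))

theorem wtildeMap_tmul (a b : H) :
    wtildeMap e (a ⊗ₜ b) = ∑ i, S k H (e i * a) ⊗ₜ mk (e.coord i) b := by
  simp [wtildeMap]

theorem Wtilde_eq : Wtilde e = epsFst k H (wtildeMap e (U k H)) := by
  simp only [Wtilde, wtildeMap, LinearMap.sum_apply, map_sum]
  refine Finset.sum_congr rfl fun i _ => ?_
  rw [epsFst, ← LinearMap.comp_apply, ← TensorProduct.map_comp, LinearMap.id_comp]

theorem leg12_wtilde (a b : H) : leg12 (epsFst k H (wtildeMap e (a ⊗ₜ b))) =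
    ∑ i, (epsMk k (S k H (e i * a)) ⊗ₜ mk (e.coord i) b) ⊗ₜ epsMk k (1 : H) := by
  rw [wtildeMap_tmul, map_sum]
  exact TensorProduct.sum_tmul _ _ _

theorem leg13_wtilde (a b : H) : leg13 (epsFst k H (wtildeMap e (a ⊗ₜ b))) =
    ∑ i, (epsMk k (S k H (e i * a)) ⊗ₜ epsMk k (1 : H)) ⊗ₜ mk (e.coord i) b := by
  rw [wtildeMap_tmul, map_sum]
  exact map_sum _ _ _

theorem leg23_wtilde (a b : H) : leg23 (epsFst k H (wtildeMap e (a ⊗ₜ b))) =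
    ∑ i, (epsMk k (1 : H) ⊗ₜ epsMk k (S k H (e i * a))) ⊗ₜ mk (e.coord i) b := by
  simp [wtildeMap_tmul, leg23, TensorProduct.tmul_sum]

/-- `a ⊗ b ↦ (ε # S(y a)) ⊗ (ξ # b)`. -/
def pairS (y : H) (ξ : Module.Dual k H) :
    H ⊗[k] H →ₗ[k] HeisenbergDouble k H ⊗[k] HeisenbergDouble k H :=
  TensorProduct.map (epsMk k ∘ₗ S k H ∘ₗ LinearMap.mulLeft k y) (mkLin ξ)

@[simp] theorem pairS_tmul (y : H) (ξ : Module.Dual k H) (a b : H) :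
    pairS y ξ (a ⊗ₜ b) = epsMk k (S k H (y * a)) ⊗ₜ mk ξ b := rfl

/-- Anti-multiplicativity of S turns the left factor S(x) into a right factor x inside S. -/
theorem sum_epsMk_tmul_hitMk (x r₁ r₂ : H) (s : H ⊗[k] H) :
    ∑ i, epsMk k (S k H x * S k H (e i * r₁)) ⊗ₜ[k] hitMk (e.coord i) r₂ s =
      ∑ i, pairS (e i) (e.coord i) (s * (r₁ ⊗ₜ r₂) * (x ⊗ₜ 1)) := by
  have h := sum_tmul_hitMk e (epsMk k ∘ₗ LinearMap.mulLeft k (S k H x) ∘ₗ S k H) r₁ r₂ s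
  refine h.trans (Finset.sum_congr rfl fun i _ => ?_)
  generalize s * (r₁ ⊗ₜ[k] r₂) = t
  induction t using TensorProduct.induction_on with
  | zero => simp
  | tmul a b => simp [mul_assoc]
  | add x y hx hy => simp only [map_add, mul_add, add_mul, hx, hy]

theorem uAct_add (x y : H ⊗[k] H) : uAct k H (x + y) = uAct k H x + uAct k H y :=
  TensorProduct.ext' fun a b => by simp [mul_add, add_mul]

theorem uAct_zero : uAct k H 0 = 0 := TensorProduct.ext' fun a b => by simp

/-- Three independent tensors replace the copies of U so that each can be reduced to a pure tensor.
The third leg gives Φ⁻¹ (id ⊗ Δ)(p)(1 ⊗ q); the first two give the action through r. -/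
theorem leg23_leg13_leg12_wtilde (p q r : H ⊗[k] H) :
    leg23 (epsFst k H (wtildeMap e p)) * leg13 (epsFst k H (wtildeMap e q)) *
      leg12 (epsFst k H (wtildeMap e r)) =
    ∑ i, ∑ m, TensorProduct.map (pairS (e i) (e.coord i) ∘ₗ uAct k H r) (mkLin (e.coord m))
      (comulFst k H (e m ⊗ₜ 1) * (PhiInv k H * (comulSnd k H p * one_tmul₂ k H q))) := by
  induction p using TensorProduct.induction_on with
  | zero => simp
  | add x y hx hy =>
    simp only [map_add, leg23_add, add_mul, mul_add, hx, hy, Finset.sum_add_distrib]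
  | tmul p₁ p₂ =>
    induction q using TensorProduct.induction_on with
    | zero => simp
    | add x y hx hy =>
      simp only [map_add, leg13_add, add_mul, mul_add, hx, hy, Finset.sum_add_distrib]
    | tmul q₁ q₂ =>
      induction r using TensorProduct.induction_on with
      | zero => simp [uAct_zero]
      | add x y hx hy =>
        simp only [map_add, leg12_add, mul_add, hx, hy, Finset.sum_add_distrib, uAct_add,
          LinearMap.comp_add, TensorProduct.map_add_left, LinearMap.add_apply]
      | tmul r₁ r₂ =>
        have h₁ : ∀ l j : I, mk (e.coord l) p₂ * mk (e.coord j) q₂ = convMk (e.coord l) (e.coord j)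
            q₂ (PhiInv k H * (TensorProduct.assoc k H H H).symm (1 ⊗ₜ comul k H p₂)) :=
          fun l j => mk_mul_mk' _ _ _ _
        have h₂ : PhiInv k H * (TensorProduct.assoc k H H H).symm (1 ⊗ₜ comul k H p₂) *
            ((p₁ ⊗ₜ q₁) ⊗ₜ q₂) =
            PhiInv k H * (comulSnd k H (p₁ ⊗ₜ p₂) * one_tmul₂ k H (q₁ ⊗ₜ q₂)) := by
          rw [comulSnd_tmul, ← assoc_symm_one_tmul, assoc_symm_mul, mul_assoc,
            ← TensorProduct.assoc_symm_tmul, assoc_symm_mul, one_mul, mul_one]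
        have h₃ : ∀ l j : I, comul k H (S k H (e l * p₁)) * (r₁ ⊗ₜ r₂) * ((e j * q₁) ⊗ₜ 1) =
            uAct k H (r₁ ⊗ₜ r₂) ((e l ⊗ₜ e j) * (p₁ ⊗ₜ q₁)) := by
          intro l j
          rw [Algebra.TensorProduct.tmul_mul_tmul, uAct_tmul]
        rw [leg12_wtilde, leg13_wtilde, leg23_wtilde]
        rw [sum_mul_sum_mul_sum]
        simp only [Algebra.TensorProduct.tmul_mul_tmul, epsMk_mul_epsMk, mul_epsMk_one, one_mul,
          epsMk_mul_mk, h₁, ← TensorProduct.sum_tmul, sum_epsMk_tmul_hitMk, h₃]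
        simp only [TensorProduct.sum_tmul]
        rw [sum_comm₃]
        refine Finset.sum_congr rfl fun i _ => ?_
        have h₄ := sum_tmul_convMk e (pairS (e i) (e.coord i) ∘ₗ uAct k H (r₁ ⊗ₜ r₂)) (p₁ ⊗ₜ q₁) q₂
          (PhiInv k H * (TensorProduct.assoc k H H H).symm (1 ⊗ₜ comul k H p₂))
        rw [h₂] at h₄
        refine Eq.trans ?_ h₄
        refine Finset.sum_congr rfl fun l _ => Finset.sum_congr rfl fun j _ => ?_
        rw [LinearMap.comp_apply, Algebra.TensorProduct.tmul_mul_tmul]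

theorem pairS_mul_epsMk (y : H) (ξ : Module.Dual k H) (t : H ⊗[k] H) (b : H) :
    pairS y ξ t * (epsMk k (1 : H) ⊗ₜ epsMk k b) = pairS y ξ (t * (1 ⊗ₜ b)) := by
  induction t using TensorProduct.induction_on with
  | zero => simp
  | tmul a c => simp [mul_epsMk_one, mk_mul_epsMk]
  | add x y hx hy => simp only [map_add, add_mul, hx, hy]

/-- The factor Δ(w) ends up next to U, where `uAct_uElt_comul` absorbs it. This removes the Δ ⊗ id
in `rMap`. -/
theorem uAct_comul_mul (w : H) (t : H ⊗[k] H) : uAct k H (uElt k H) (comul k H w * t) =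
    uAct k H (uElt k H) t * (1 ⊗ₜ S k H w) := by
  have key : ∀ (s : H ⊗[k] H) (a b : H), uAct k H (uElt k H) (s * (a ⊗ₜ b)) =
      comul k H (S k H a) * uAct k H (uElt k H) s * (b ⊗ₜ 1) := by
    intro s a b
    induction s using TensorProduct.induction_on with
    | zero => simp
    | tmul x y => simp [mul_assoc]
    | add x y hx hy => simp only [map_add, add_mul, mul_add, hx, hy]
  induction t using TensorProduct.induction_on with
  | zero => simp
  | tmul a b => simp [key, uAct_uElt_comul, mul_assoc]
  | add x y hx hy => simp only [map_add, add_mul, mul_add, hx, hy]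

/-- `a ⊗ b ⊗ c ↦ (ε # S(c)) ⊗ (ε # S(b)) ⊗ (ε # S(a))`. -/
def epsS₃ : (H ⊗[k] H) ⊗[k] H →ₗ[k] (H ⊗[k] H) ⊗[k] H :=
  (TensorProduct.assoc k H H H).symm.toLinearMap ∘ₗ
    TensorProduct.map (S k H) (flipS k H) ∘ₗ (TensorProduct.comm k (H ⊗[k] H) H).toLinearMap

@[simp] theorem epsS₃_tmul (a b c : H) :
    epsS₃ ((a ⊗ₜ[k] b) ⊗ₜ c) = (S k H c ⊗ₜ S k H b) ⊗ₜ S k H a := by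
  simp [epsS₃]

variable (k H) in
theorem Phi321S_eq : Phi321S k H = eps₃ k H (epsS₃ (Phi k H)) := by
  have key : ∀ y, (TensorProduct.assoc k (HeisenbergDouble k H) (HeisenbergDouble k H)
    (HeisenbergDouble k H)).symm
    (TensorProduct.map (epsMk k ∘ₗ QuasiHopf.S k H)
      (TensorProduct.map (epsMk k ∘ₗ QuasiHopf.S k H) (epsMk k ∘ₗ QuasiHopf.S k H) ∘ₗ
        (TensorProduct.comm k H H).toLinearMap)
      (TensorProduct.comm k (H ⊗[k] H) H y)) = eps₃ k H (epsS₃ y) := by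
    intro y
    induction y using tensor_induction₃ with
    | zero => simp
    | tmul a b c => simp
    | add x y hx hy => simp only [map_add, hx, hy]
  exact key _

theorem epsS₃_leg12_leg23_wtilde (x₁ x₂ x₃ : H) (p r : H ⊗[k] H) :
    eps₃ k H (epsS₃ ((x₁ ⊗ₜ x₂) ⊗ₜ x₃)) * leg12 (epsFst k H (wtildeMap e r)) *
      leg23 (epsFst k H (wtildeMap e p)) =
    ∑ i, ∑ m, TensorProduct.map (pairS (e i) (e.coord i) ∘ₗ
        LinearMap.mulLeft k (uAct k H r (x₂ ⊗ₜ x₃)) ∘ₗ TensorProduct.mk k H H 1 ∘ₗ S k H)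
      (mkLin (e.coord m)) ((e m ⊗ₜ 1) * (comul k H (S k H x₁) * p)) := by
  induction p using TensorProduct.induction_on with
  | zero => simp
  | add x y hx hy =>
    simp only [map_add, leg23_add, mul_add, hx, hy, Finset.sum_add_distrib]
  | tmul p₁ p₂ =>
    have h₂ : eps₃ k H (epsS₃ ((x₁ ⊗ₜ x₂) ⊗ₜ x₃)) * leg12 (epsFst k H (wtildeMap e r)) =
        ∑ i, pairS (e i) (e.coord i) (uAct k H r (x₂ ⊗ₜ x₃)) ⊗ₜ epsMk k (S k H x₁) := by
      induction r using TensorProduct.induction_on with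
      | zero => simp [uAct_zero]
      | add x y hx hy =>
        simp only [map_add, leg12_add, mul_add, hx, hy, uAct_add, LinearMap.add_apply,
          TensorProduct.add_tmul, Finset.sum_add_distrib]
      | tmul r₁ r₂ =>
        rw [leg12_wtilde, Finset.mul_sum]
        simp only [epsS₃_tmul, eps₃_tmul, Algebra.TensorProduct.tmul_mul_tmul, epsMk_mul_epsMk,
          epsMk_mul_mk, mul_one, ← TensorProduct.sum_tmul, sum_epsMk_tmul_hitMk, uAct_tmul]
    have h₁ : ∀ i, pairS (e i) (e.coord i) ∘ₗ
        LinearMap.mulLeft k (uAct k H r (x₂ ⊗ₜ x₃)) ∘ₗ TensorProduct.mk k H H 1 ∘ₗ S k H =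
        LinearMap.mulLeft k (pairS (e i) (e.coord i) (uAct k H r (x₂ ⊗ₜ x₃))) ∘ₗ
          TensorProduct.mk k _ _ (epsMk k 1) ∘ₗ epsMk k ∘ₗ S k H :=
      fun i => LinearMap.ext fun w => (pairS_mul_epsMk _ _ _ _).symm
    simp only [h₁, ← sum_tmul_hitMk]
    rw [h₂, leg23_wtilde, Finset.sum_mul_sum]
    simp only [Algebra.TensorProduct.tmul_mul_tmul, epsMk_mul_mk, LinearMap.comp_apply,
      LinearMap.mulLeft_apply, TensorProduct.mk_apply]

/-- The previous lemma has 1 ⊗ S(w) in its second leg; by `uAct_comul_mul` this equals Δ(w) under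
the action through U, which matches the form of `rMap`. -/
theorem epsS₃_Phi_leg12_leg23_wtilde (y : (H ⊗[k] H) ⊗[k] H) :
    eps₃ k H (epsS₃ y) * leg12 (epsFst k H (wtildeMap e (uElt k H))) *
      leg23 (epsFst k H (wtildeMap e (uElt k H))) =
    ∑ i, ∑ m, TensorProduct.map (pairS (e i) (e.coord i) ∘ₗ uAct k H (uElt k H))
      (mkLin (e.coord m)) (comulFst k H (e m ⊗ₜ 1) * rMap k H (uElt k H) y) := by
  induction y using tensor_induction₃ with
  | zero => simp
  | add x y hx hy => simp only [map_add, add_mul, mul_add, hx, hy, Finset.sum_add_distrib]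
  | tmul x₁ x₂ x₃ =>
    rw [epsS₃_leg12_leg23_wtilde]
    refine Finset.sum_congr rfl fun i _ => Finset.sum_congr rfl fun m _ => ?_
    rw [rMap_tmul, ← mul_assoc (comulFst k H _), ← map_mul]
    generalize (e m ⊗ₜ[k] (1 : H)) * (comul k H (S k H x₁) * uElt k H) = s
    induction s using TensorProduct.induction_on with
    | zero => simp
    | tmul a b => simp [uAct_comul_mul, mul_assoc]
    | add x y hx hy => simp only [map_add, add_mul, hx, hy]

end Hopf
end HeisenbergDouble

end

open HeisenbergDouble in
theorem theorem4p4 {k H : Type*} [Field k] [Ring H] [Algebra k H] [FiniteDimensional k H]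
    [QuasiHopfAlgebra k H] {I : Type*} [Fintype I] (e : Module.Basis I k H) :
    -- the inverses in the definition of `U` exist
    Function.Bijective (QuasiHopf.S k H) ∧
    QuasiHopf.twist k H * QuasiHopf.twistInv k H = 1 ∧
    QuasiHopf.twistInv k H * QuasiHopf.twist k H = 1 ∧
    -- the triple products do not depend on the brackets
    (leg12 (W e) * leg13 (W e)) * leg23 (W e) = leg12 (W e) * (leg13 (W e) * leg23 (W e)) ∧
    (leg23 (W e) * leg12 (W e)) * PhiInvBold k H =
      leg23 (W e) * (leg12 (W e) * PhiInvBold k H) ∧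
    (leg23 (Wtilde e) * leg13 (Wtilde e)) * leg12 (Wtilde e) =
      leg23 (Wtilde e) * (leg13 (Wtilde e) * leg12 (Wtilde e)) ∧
    (Phi321S k H * leg12 (Wtilde e)) * leg23 (Wtilde e) =
      Phi321S k H * (leg12 (Wtilde e) * leg23 (Wtilde e)) ∧
    -- the quasi-pentagon equation
    (leg12 (W e) * leg13 (W e)) * leg23 (W e) =
      (leg23 (W e) * leg12 (W e)) * PhiInvBold k H ∧
    -- the quasi-Hopf equation
    (leg23 (Wtilde e) * leg13 (Wtilde e)) * leg12 (Wtilde e) =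
      (Phi321S k H * leg12 (Wtilde e)) * leg23 (Wtilde e) := by
  have hS := QuasiHopf.S_bijective k H
  refine ⟨hS, QuasiHopf.twist_mul_twistInv k H, QuasiHopf.twistInv_mul_twist k H, ?_, ?_, ?_, ?_,
    ?_, ?_⟩
  · rw [W_eq]
    exact leg12_leg13_leg23_assoc _ _ _
  · rw [W_eq]
    exact leg23_leg12_eps₃_assoc _ _ _
  · rw [Wtilde_eq]
    exact leg23_leg13_leg12_assoc _ _ _
  · rw [Wtilde_eq, Phi321S_eq]
    exact eps₃_leg12_leg23_assoc _ _ _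
  · rw [leg12_leg13_leg23_W, leg23_leg12_W_PhiInvBold]
  -- Both sides are now the same map applied to the two sides of the identity for U.
  · rw [Wtilde_eq, Phi321S_eq, QuasiHopf.U_eq hS, leg23_leg13_leg12_wtilde,
      QuasiHopf.PhiInv_mul_comulSnd_uElt, epsS₃_Phi_leg12_leg23_wtilde]
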